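/- Let $\mathbb F_q$ be a finite field with $q$ elements and let $V$ be a non-zero finite dimensional $\mathbb F_q$-vector space. Let $S_V$ be the symmetric algebra of $V$ over $\mathbb F_q$, let $K_V$ be its field of fractions, and let $R_V\subset K_V$ be the $\mathbb F_q$-subalgebra generated by the elements $\frac1v$ for all $v\in V\setminus\{0\}$, graded such that every $\frac1v$ is homogeneous of degree $-1$. Let $Q_V:=\operatorname{Proj} R_V$, where Proj is formed with the inverted grading, so that each $\frac1v$ defines a global section of $\mathcal O_{Q_V}(1)$, and let $\tilde Q_V:=\operatorname{Spec} R_V$; both are schemes over $\mathbb F_q$. For a scheme $S$ over $\mathbb F_q$ and an invertible sheaf $\mathcal L$ on $S$, a *reciprocal map* $\rho: V\setminus\{0\}\to\Gamma(S,\mathcal L)$ is a map such that (a) $\rho(\alpha v)=\alpha^{-1}\rho(v)$ for all $v\in V\setminus\{0\}$ and $\alpha\in\mathbb F_q^\times$, and (b) $\rho(v)\cdot\rho(v')=\rho(v+v')\cdot(\rho(v)+\rho(v'))$ in $\Gamma(S,\mathcal L^{\otimes 2})$ for all $v,v'\in V\setminus\{0\}$ with $v+v'\neq0$. It is called *fiberwise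 non-zero* if for every $s\in S$ the composite map $V\setminus\{0\}\to\Gamma(S,\mathcal L)\to\mathcal L\otimes_{\mathcal O_S}k(s)$ is not identically zero. Two pairs $(\mathcal L,\rho)$ and $(\mathcal L',\rho')$ on $S$ are isomorphic if there is an isomorphism $\mathcal L\cong\mathcal L'$ of sheaves of $\mathcal O_S$-modules that sends $\rho(v)$ to $\rho'(v)$ for all $v$. **Theorem.** 1. The sheaf $\mathcal O_{Q_V}(1)$ is invertible, the map $\rho_V:V\setminus\{0\}\to\Gamma(Q_V,\mathcal O_{Q_V}(1))$, $v\mapsto\frac1v$, is a fiberwise non-zero reciprocal map, and the scheme $Q_V$ with the universal family $(\mathcal O_{Q_V}(1),\rho_V)$ represents the contravariant functor (with pullback of pairs as transition maps) that associates to a scheme $S$ over $\mathbb F_q$ the set of isomorphism classes of pairs $(\mathcal L,\rho)$ consisting of an invertible sheaf $\mathcal L$ on $S$ and a fiberwise non-zero reciprocal map $\rho:V\setminus\{0\}\to\Gamma(S,\mathcal L)$. 2. The map $\tilde\rho_V:V\setminus\{0\}\to R_V\cong\Gamma(\tilde Q_V,\mathcal O_{\tilde Q_V})$, $v\mapsto\frac1v$,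 is reciprocal, and the scheme $\tilde Q_V$ with the universal reciprocal map $\tilde\rho_V$ represents the contravariant functor that associates to a scheme $S$ over $\mathbb F_q$ the set of all reciprocal maps $V\setminus\{0\}\to\Gamma(S,\mathcal O_S)$. -/

import Mathlib

open CategoryTheory AlgebraicGeometry TopologicalSpace Opposite

universe u

noncomputable section

namespace RecipMaps

section Ring

variable (F : Type u) [Field F] (V : Type u) [AddCommGroup V] [Module F V]

/-- `V ∖ {0}`. -/
abbrev Nonzero (V : Type u) [Zero V] : Type u := {v : V // v ≠ 0}

/-- `K_V`, the field of fractions of the symmetric algebra `S_V` of `V`. -/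
abbrev KV : Type u := FractionRing (SymmetricAlgebra F V)

/-- The canonical map `V → S_V → K_V`. -/
def toKV (v : V) : KV F V :=
  algebraMap (SymmetricAlgebra F V) (KV F V) (SymmetricAlgebra.ι F V v)

/-- `R_V`, the `F`-subalgebra of `K_V` generated by all `1/v` with `v ∈ V ∖ {0}`. -/
def RV : Subalgebra F (KV F V) :=
  Algebra.adjoin F (Set.range fun v : Nonzero V => (toKV F V v.1)⁻¹)

/-- The element `1/v` of `R_V`. -/
def recip (v : Nonzero V) : RV F V :=
  ⟨(toKV F V v.1)⁻¹, Algebra.subset_adjoin ⟨v, rfl⟩⟩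

/-- The homogeneous part of degree `-n` of `R_V`, in which every `1/v` has degree `-1`:
it is spanned over `F` by the `n`-fold products of elements `1/v`. -/
def gradeRV (n : ℕ) : Submodule F (RV F V) :=
  Submodule.span F (Set.range (recip F V)) ^ n

/-- The substitution `v ↦ v X`, from `S_V` to polynomials over `K_V`. -/
def scaleS : SymmetricAlgebra F V →ₐ[F] Polynomial (KV F V) :=
  SymmetricAlgebra.lift
    { toFun := fun v => Polynomial.C (toKV F V v) * Polynomial.X
      map_add' := fun a b => by simp [toKV, add_mul]
      map_smul' := fun a b => by
        rw [RingHom.id_apply, ← smul_mul_assoc, Polynomial.smul_C]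
        simp [toKV, Algebra.smul_def, ← IsScalarTower.algebraMap_apply] }

lemma scaleS_injective : Function.Injective (scaleS F V) := by
  have h : ((Polynomial.aeval (R := KV F V) (1 : KV F V)).restrictScalars F).comp (scaleS F V) =
      IsScalarTower.toAlgHom F (SymmetricAlgebra F V) (KV F V) := by
    apply SymmetricAlgebra.algHom_ext
    ext v
    simp [scaleS, toKV]
  intro a b hab
  apply IsFractionRing.injective (SymmetricAlgebra F V) (KV F V)
  have := congrArg (fun f => f a) h
  have h2 := congrArg (fun f => f b) h
  simp only [AlgHom.comp_apply, hab] at this h2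
  exact this.symm.trans h2

/-- The homomorphism `K → K((X))` extending an injective homomorphism `S → K[X]`, where `K` is
the field of fractions of `S`. -/
def extendToLaurent {S K : Type u} [CommRing S] [IsDomain S] [Field K] [Algebra S K]
    [IsFractionRing S K] (φ : S →+* Polynomial K) (hφ : Function.Injective φ) :
    K →+* LaurentSeries K :=
  IsFractionRing.lift
    (g := ((HahnSeries.ofPowerSeries ℤ K).comp Polynomial.coeToPowerSeries.ringHom).comp φ)
    ((HahnSeries.ofPowerSeries_injective.comp (Polynomial.coe_injective _)).comp hφ)

lemma extendToLaurent_algebraMap {S K : Type u} [CommRing S] [IsDomain S] [Field K] [Algebra S K]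
    [IsFractionRing S K] (φ : S →+* Polynomial K) (hφ : Function.Injective φ) (s : S) :
    extendToLaurent φ hφ (algebraMap S K s) =
      HahnSeries.ofPowerSeries ℤ K (Polynomial.coeToPowerSeries.ringHom (φ s)) :=
  IsFractionRing.lift_algebraMap _ _

/-- The substitution `v ↦ v X` on `K_V`. -/
def scaleK : KV F V →+* LaurentSeries (KV F V) :=
  extendToLaurent (scaleS F V).toRingHom (scaleS_injective F V)

lemma scaleK_toKV (v : V) : scaleK F V (toKV F V v) = HahnSeries.single 1 (toKV F V v) := by
  rw [scaleK, toKV, extendToLaurent_algebraMap]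
  simp [scaleS, toKV, HahnSeries.C_apply]

lemma scaleK_algebraMap (a : F) :
    scaleK F V (algebraMap F _ a) = HahnSeries.single 0 (algebraMap F _ a) := by
  rw [scaleK, IsScalarTower.algebraMap_apply F (SymmetricAlgebra F V) (KV F V),
    extendToLaurent_algebraMap]
  simp only [AlgHom.toRingHom_eq_coe, RingHom.coe_coe, AlgHom.commutes]
  simp [Polynomial.algebraMap_apply, HahnSeries.C_apply, ← IsScalarTower.algebraMap_apply]

lemma scaleK_recip (v : Nonzero V) :
    scaleK F V (recip F V v).1 = HahnSeries.single (-1) (recip F V v).1 := by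
  simp [recip, scaleK_toKV, HahnSeries.inv_single]

lemma scaleK_grade (n : ℕ) (r : RV F V) (hr : r ∈ gradeRV F V n) :
    scaleK F V r.1 = HahnSeries.single (-n : ℤ) r.1 := by
  induction n generalizing r with
  | zero =>
    rw [gradeRV, pow_zero, Submodule.mem_one] at hr
    obtain ⟨a, rfl⟩ := hr
    simpa using scaleK_algebraMap F V a
  | succ n ih =>
    rw [gradeRV, pow_succ] at hr
    induction hr using Submodule.mul_induction_on' with
    | mem_mul_mem a ha b hb =>
      have hb' : scaleK F V b.1 = HahnSeries.single (-1) b.1 := by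
        induction hb using Submodule.span_induction with
        | mem x h => obtain ⟨v, rfl⟩ := h; exact scaleK_recip F V v
        | zero => simp
        | add x y _ _ hx hy => simp [hx, hy]
        | smul c x _ hx =>
          rw [Subalgebra.coe_smul, Algebra.smul_def, map_mul, hx, scaleK_algebraMap,
            HahnSeries.single_mul_single, zero_add]
      rw [Subalgebra.coe_mul, map_mul, ih a ha, hb', HahnSeries.single_mul_single]
      rw [show (-(n : ℤ)) + -1 = -((n + 1 : ℕ) : ℤ) by push_cast; ring]
    | add x _ y _ hx hy => simp [hx, hy]

lemma isInternal_gradeRV : DirectSum.IsInternal (gradeRV F V) := by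
  apply DirectSum.isInternal_submodule_of_iSupIndep_of_iSup_eq_top
  · rw [iSupIndep_iff_finsetSum_eq_zero_imp_eq_zero]
    intro s r hr h i hi
    have h1 : ∑ j ∈ s, HahnSeries.single (-j : ℤ) (r j).1 = 0 := by
      rw [← Finset.sum_congr rfl fun j hj => scaleK_grade F V j (r j) (hr j hj), ← map_sum,
        ← AddSubmonoidClass.coe_finsetSum, h]
      simp
    have h2 := congrArg (fun x => HahnSeries.coeff x (-i : ℤ)) h1
    rw [HahnSeries.coeff_sum, Finset.sum_eq_single i] at h2
    · apply Subtype.ext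
      simpa using h2
    · intro j _ hj
      exact HahnSeries.coeff_single_of_ne (by simpa using fun h => hj h.symm)
    · exact fun h => absurd hi h
  · rw [eq_top_iff]
    rintro ⟨x, hx⟩ -
    induction hx using Algebra.adjoin_induction with
    | mem x h =>
      obtain ⟨v, rfl⟩ := h
      exact Submodule.mem_iSup_of_mem 1
        (by rw [gradeRV, pow_one]; exact Submodule.subset_span ⟨v, rfl⟩)
    | algebraMap r =>
      exact Submodule.mem_iSup_of_mem 0
        (by rw [gradeRV, pow_zero]; exact Submodule.mem_one.2 ⟨r, rfl⟩)
    | add x y hx hy h1 h2 => exact add_mem h1 h2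
    | mul x y hx hy h1 h2 =>
      have : (⟨x * y, mul_mem hx hy⟩ : RV F V) = ⟨x, hx⟩ * ⟨y, hy⟩ := rfl
      rw [this]
      have h3 := Submodule.mul_mem_mul h1 h2
      rw [Submodule.iSup_mul] at h3
      have h4 : ⨆ i, gradeRV F V i * ⨆ j, gradeRV F V j ≤ ⨆ n, gradeRV F V n := by
        refine iSup_le fun i => ?_
        rw [Submodule.mul_iSup]
        refine iSup_le fun j => ?_
        have h5 : gradeRV F V i * gradeRV F V j = gradeRV F V (i + j) := (pow_add _ i j).symm
        rw [h5]
        exact le_iSup (gradeRV F V) (i + j)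
      exact h4 h3

instance gradedAlgebra_gradeRV : GradedAlgebra (gradeRV F V) where
  one_mem := by
    rw [gradeRV, pow_zero]
    exact Submodule.one_le.1 le_rfl
  mul_mem := fun i j a b ha hb => by
    unfold gradeRV at *
    rw [pow_add]
    exact Submodule.mul_mem_mul ha hb
  toDecomposition := (isInternal_gradeRV F V).chooseDecomposition

end Ring

section Twist

variable {A : Type u} {σ : Type*} [CommRing A] [SetLike σ A] [AddSubgroupClass σ A]
  (𝒜 : ℕ → σ) [GradedRing 𝒜]

instance LocAt.isPrime (x : ProjectiveSpectrum.top 𝒜) :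
    (ProjectiveSpectrum.asHomogeneousIdeal (𝒜 := 𝒜) x).toIdeal.IsPrime :=
  ProjectiveSpectrum.isPrime (𝒜 := 𝒜) x

/-- The localization of the graded ring at the homogeneous prime ideal `x`. -/
abbrev LocAt (x : ProjectiveSpectrum.top 𝒜) : Type u :=
  Localization.AtPrime (ProjectiveSpectrum.asHomogeneousIdeal (𝒜 := 𝒜) x).toIdeal

/-- Dependent functions on `U` given by a single fraction `r / s` with `deg r = deg s + d`. -/
def twistPrelocal (d : ℕ) :
    TopCat.PrelocalPredicate fun x : ProjectiveSpectrum.top 𝒜 => LocAt 𝒜 x where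
  pred {U} f := ∃ (i : ℕ) (r : 𝒜 (i + d)) (s : 𝒜 i) (hs : ∀ x : U, s.1 ∉ x.1.asHomogeneousIdeal),
    ∀ x : U, f x = (Localization.mk r.1 ⟨s.1, hs x⟩ : LocAt 𝒜 x.1)
  res := by rintro V U i f ⟨j, r, s, h, w⟩; exact ⟨j, r, s, (h <| i ·), (w <| i ·)⟩

/-- Dependent functions that are locally given by a fraction of degree `d`. -/
def twistLocal (d : ℕ) :
    TopCat.LocalPredicate fun x : ProjectiveSpectrum.top 𝒜 => LocAt 𝒜 x :=
  (twistPrelocal 𝒜 d).sheafify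

/-- Sections of `𝒪(d)` over `U`. -/
def twistSections (d : ℕ) (U : (Opens (ProjectiveSpectrum.top 𝒜))ᵒᵖ) :
    AddSubgroup (∀ x : U.unop, LocAt 𝒜 x.1) where
  carrier := {f | (twistLocal 𝒜 d).pred f}
  zero_mem' := fun x => ⟨U.unop, x.2, 𝟙 _, 0, ⟨0, zero_mem _⟩, ⟨1, SetLike.GradedOne.one_mem⟩,
    fun y => (ProjectiveSpectrum.isPrime (𝒜 := 𝒜) y.1).one_notMem,
    fun y => (Localization.mk_zero _).symm⟩
  add_mem' := fun {a b} ha hb x => by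
    obtain ⟨Va, ma, ia, ja, ⟨ra, hra⟩, ⟨sa, hsa⟩, hwa, wa⟩ := ha x
    obtain ⟨Vb, mb, ib, jb, ⟨rb, hrb⟩, ⟨sb, hsb⟩, hwb, wb⟩ := hb x
    refine ⟨Va ⊓ Vb, ⟨ma, mb⟩, Opens.infLELeft _ _ ≫ ia, ja + jb, ⟨sa * rb + sb * ra, ?_⟩,
      ⟨sa * sb, SetLike.mul_mem_graded hsa hsb⟩, fun y =>
        (ProjectiveSpectrum.asHomogeneousIdeal (𝒜 := 𝒜) y.1).toIdeal.primeCompl.mul_mem (hwa ⟨y.1, y.2.1⟩) (hwb ⟨y.1, y.2.2⟩), fun y => ?_⟩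
    · refine add_mem ?_ ?_
      · rw [add_assoc]
        exact SetLike.mul_mem_graded hsa hrb
      · rw [show ja + jb + d = jb + (ja + d) by ring]
        exact SetLike.mul_mem_graded hsb hra
    · refine (congrArg₂ (· + ·) (wa ⟨y.1, y.2.1⟩) (wb ⟨y.1, y.2.2⟩)).trans ?_
      exact Localization.add_mk _ _ _ _
  neg_mem' := fun {a} ha x => by
    obtain ⟨Va, ma, ia, ja, ⟨ra, hra⟩, ⟨sa, hsa⟩, hwa, wa⟩ := ha x
    refine ⟨Va, ma, ia, ja, ⟨-ra, neg_mem hra⟩, ⟨sa, hsa⟩, hwa, fun y => ?_⟩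
    exact (congrArg Neg.neg (wa y)).trans (Localization.neg_mk _ _)

/-- The underlying sheaf of sets of `𝒪(d)`. -/
def twistInType (d : ℕ) : TopCat.Sheaf (Type u) (ProjectiveSpectrum.top 𝒜) :=
  TopCat.subsheafToTypes (twistLocal 𝒜 d)

instance twistAddCommGroup (d : ℕ) (U : (Opens (ProjectiveSpectrum.top 𝒜))ᵒᵖ) :
    AddCommGroup ((twistInType 𝒜 d).1.obj U) :=
  (twistSections 𝒜 d U).toAddCommGroup

instance twistModule (d : ℕ) (U : (Opens (ProjectiveSpectrum.top 𝒜))ᵒᵖ) :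
    Module ((ProjectiveSpectrum.Proj.structureSheaf 𝒜).1.obj U) ((twistInType 𝒜 d).1.obj U) where
  smul g s := ⟨fun x => ((g.1 x).val * s.1 x : LocAt 𝒜 x.1), fun x => by
    obtain ⟨Va, ma, ia, ja, ⟨ra, hra⟩, ⟨sa, hsa⟩, hwa, wa⟩ := g.2 x
    obtain ⟨Vb, mb, ib, jb, ⟨rb, hrb⟩, ⟨sb, hsb⟩, hwb, wb⟩ := s.2 x
    refine ⟨Va ⊓ Vb, ⟨ma, mb⟩, Opens.infLELeft _ _ ≫ ia, ja + jb, ⟨ra * rb, ?_⟩,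
      ⟨sa * sb, SetLike.mul_mem_graded hsa hsb⟩, fun y =>
        (ProjectiveSpectrum.asHomogeneousIdeal (𝒜 := 𝒜) y.1).toIdeal.primeCompl.mul_mem
          (hwa ⟨y.1, y.2.1⟩) (hwb ⟨y.1, y.2.2⟩), fun y => ?_⟩
    · rw [add_assoc]
      exact SetLike.mul_mem_graded hra hrb
    · refine (congrArg₂ (· * ·) (congrArg HomogeneousLocalization.val (wa ⟨y.1, y.2.1⟩))
        (wb ⟨y.1, y.2.2⟩)).trans ?_
      exact Localization.mk_mul _ _ _ _⟩
  one_smul s := Subtype.ext <| funext fun x =>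
    (congrArg (· * (s.1 x : LocAt 𝒜 x.1)) (HomogeneousLocalization.val_one)).trans (one_mul _)
  mul_smul g h s := Subtype.ext <| funext fun x =>
    (congrArg (· * (s.1 x : LocAt 𝒜 x.1)) (HomogeneousLocalization.val_mul _ _)).trans
      (mul_assoc _ _ _)
  smul_zero g := Subtype.ext <| funext fun x => mul_zero (g.1 x).val
  smul_add g s t := Subtype.ext <| funext fun x => mul_add (g.1 x).val _ _
  add_smul g h s := Subtype.ext <| funext fun x =>
    (congrArg (· * (s.1 x : LocAt 𝒜 x.1)) (HomogeneousLocalization.val_add _ _)).trans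
      (add_mul _ _ _)
  zero_smul s := Subtype.ext <| funext fun x =>
    (congrArg (· * (s.1 x : LocAt 𝒜 x.1)) (HomogeneousLocalization.val_zero)).trans (zero_mul _)

/-- The underlying presheaf of abelian groups of `𝒪(d)`. -/
def twistInAb (d : ℕ) : TopCat.Presheaf Ab (ProjectiveSpectrum.top 𝒜) where
  obj U := AddCommGrpCat.of ((twistInType 𝒜 d).1.obj U)
  map i := AddCommGrpCat.ofHom
    { toFun := (twistInType 𝒜 d).1.map i
      map_zero' := rfl
      map_add' := fun _ _ => rfl }

/-- The underlying presheaf of modules of `𝒪(d)`. -/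
def twistPresheaf (d : ℕ) :
    PresheafOfModules ((ProjectiveSpectrum.Proj.structureSheaf 𝒜).1 ⋙ forget₂ _ RingCat) :=
  letI (X : (Opens (ProjectiveSpectrum.top 𝒜))ᵒᵖ) :
    Module ↑(((ProjectiveSpectrum.Proj.structureSheaf 𝒜).1 ⋙ forget₂ CommRingCat RingCat).obj X)
      ↑((twistInAb 𝒜 d).obj X) := 
    inferInstanceAs (Module ((ProjectiveSpectrum.Proj.structureSheaf 𝒜).1.obj X) ((twistInType 𝒜 d).1.obj X))
  .ofPresheaf (twistInAb 𝒜 d) fun _ _ _ _ _ ↦ rfl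

/-- Serre's twisting sheaf `𝒪(d)` on `Proj 𝒜`. -/
def twist (d : ℕ) : (Proj 𝒜).Modules where
  val := twistPresheaf 𝒜 d
  isSheaf := (TopCat.Presheaf.isSheaf_iff_isSheaf_comp (forget AddCommGrpCat) _).2
    (twistInType 𝒜 d).2

/-- The global section of `𝒪(d)` defined by an element of degree `d`. -/
def twistSection (d : ℕ) (r : 𝒜 d) : (Scheme.Modules.presheaf (twist 𝒜 d)).obj (.op ⊤) :=
  (⟨fun _ => Localization.mk r.1 1, fun x => ⟨⊤, trivial, 𝟙 _, 0,
    ⟨r.1, by rw [zero_add]; exact r.2⟩, ⟨1, SetLike.GradedOne.one_mem⟩,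
    fun y => (ProjectiveSpectrum.isPrime (𝒜 := 𝒜) y.1).one_notMem, fun _ => rfl⟩⟩ : (twistInType 𝒜 d).1.obj (.op ⊤))

end Twist

/-- The structure sheaf `𝒪_S` as a module over itself. -/
def unitMod (S : Scheme.{u}) : S.Modules := SheafOfModules.unit S.ringCatSheaf

/-- An invertible sheaf: an `𝒪_S`-module that is locally isomorphic to `𝒪_S`. -/
def IsInvertible {S : Scheme.{u}} (L : S.Modules) : Prop :=
  ∀ x : S, ∃ U : S.Opens, x ∈ U ∧ Nonempty (L.restrict U.ι ≅ unitMod U)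

/-- The presheaf `U ↦ Γ(U, M) ⊗ Γ(U, N)`. -/
def tensorPre {S : Scheme.{u}} (M N : S.Modules) : S.PresheafOfModules :=
  PresheafOfModules.Monoidal.tensorObj (R := S.presheaf) M.val N.val

/-- The tensor product of two `𝒪_S`-modules: the sheafification of
`U ↦ Γ(U, M) ⊗ Γ(U, N)`. -/
def tensor {S : Scheme.{u}} (M N : S.Modules) : S.Modules :=
  (PresheafOfModules.sheafification (𝟙 S.ringCatSheaf.obj)).obj (tensorPre M N)

/-- The canonical map from the presheaf tensor product to its sheafification. -/
def toTensor {S : Scheme.{u}} (M N : S.Modules) :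
    (tensorPre M N).presheaf ⟶ (tensor M N).presheaf :=
  CategoryTheory.toSheafify (Opens.grothendieckTopology S) (tensorPre M N).presheaf

open TensorProduct in
/-- The product of two sections, as a section of the tensor product. -/
def secMul {S : Scheme.{u}} {M N : S.Modules} {U : S.Opens} (a : Γ(M, U)) (b : Γ(N, U)) :
    Γ(tensor M N, U) :=
  (toTensor M N).app (.op U) (a ⊗ₜ[Γ(S, U)] b)

section Pullback

open TensorProduct

variable {T S R : Scheme.{u}} (f : T ⟶ S) (g : S ⟶ R)

/-- Pullback of sections. -/
def pullbackSectionOn {M : S.Modules} (U : S.Opens) :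
    Γ(M, U) →+ Γ((Scheme.Modules.pullback f).obj M, f ⁻¹ᵁ U) :=
  (((Scheme.Modules.pullbackPushforwardAdjunction f).unit.app M).app U).hom

/-- Pullback of global sections. -/
def pullbackSection {M : S.Modules} (a : Γ(M, ⊤)) :
    Γ((Scheme.Modules.pullback f).obj M, ⊤) :=
  pullbackSectionOn f ⊤ a

lemma pullbackSectionOn_smul {M : S.Modules} (U : S.Opens) (r : Γ(S, U)) (a : Γ(M, U)) :
    pullbackSectionOn f U (r • a) = f.app U r • pullbackSectionOn f U a :=
  ((Scheme.Modules.pullbackPushforwardAdjunction f).unit.app M).app_smul r a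

lemma pullbackSectionOn_res {M : S.Modules} {U W : S.Opens} (i : U ⟶ W) (a : Γ(M, W)) :
    pullbackSectionOn f U (M.presheaf.map i.op a) =
      ((Scheme.Modules.pullback f).obj M).presheaf.map ((Opens.map f.base).map i).op
        (pullbackSectionOn f W a) :=
  ConcreteCategory.congr_hom 
    (((Scheme.Modules.pullbackPushforwardAdjunction f).unit.app M).mapPresheaf.naturality i.op) a

lemma pullbackSection_natural {M N : S.Modules} (φ : M ⟶ N) (a : Γ(M, ⊤)) :
    pullbackSection f (φ.app ⊤ a) =
      ((Scheme.Modules.pullback f).map φ).app ⊤ (pullbackSection f a) := by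
  have h := (Scheme.Modules.pullbackPushforwardAdjunction f).unit.naturality φ
  have h2 := congrArg (fun ψ => Scheme.Modules.Hom.app ψ ⊤) h
  exact ConcreteCategory.congr_hom h2 a

lemma pullbackSection_comp {M : R.Modules} (a : Γ(M, ⊤)) :
    pullbackSection f (pullbackSection g a) =
      ((Scheme.Modules.pullbackComp f g).inv.app M).app ⊤ (pullbackSection (f ≫ g) a) := by
  have h := unit_conjugateEquiv
    ((Scheme.Modules.pullbackPushforwardAdjunction g).comp
      (Scheme.Modules.pullbackPushforwardAdjunction f))
    (Scheme.Modules.pullbackPushforwardAdjunction (f ≫ g)) (Scheme.Modules.pullbackComp f g).inv M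
  rw [Scheme.Modules.conjugateEquiv_pullbackComp_inv] at h
  have h2 := congrArg (fun ψ => Scheme.Modules.Hom.app ψ ⊤) h
  have h3 := ConcreteCategory.congr_hom h2 a
  exact h3

lemma pullbackSection_id {M : S.Modules} (a : Γ(M, ⊤)) :
    ((Scheme.Modules.pullbackId S).hom.app M).app ⊤ (pullbackSection (𝟙 S) a) = a := by
  have h := unit_conjugateEquiv .id
    (Scheme.Modules.pullbackPushforwardAdjunction (𝟙 S)) (Scheme.Modules.pullbackId S).hom M
  rw [Scheme.Modules.conjugateEquiv_pullbackId_hom] at h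
  have h2 := congrArg (fun ψ => Scheme.Modules.Hom.app ψ ⊤) h
  exact (ConcreteCategory.congr_hom h2 a).symm

instance isRightAdjoint_pushforward :
    (SheafOfModules.pushforward.{u} f.toRingCatSheafHom).IsRightAdjoint :=
  inferInstanceAs (Scheme.Modules.pushforward f).IsRightAdjoint

instance final_opensMap : (Opens.map f.base).Final where
  out U := by
    have h : ∀ A : StructuredArrow U (Opens.map f.base), Nonempty
        (A ⟶ StructuredArrow.mk (Y := (⊤ : Opens S)) (homOfLE le_top)) := fun A =>
      ⟨StructuredArrow.homMk (homOfLE le_top) (Subsingleton.elim _ _)⟩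
    have : Nonempty (StructuredArrow U (Opens.map f.base)) :=
      ⟨StructuredArrow.mk (Y := (⊤ : Opens S)) (homOfLE le_top)⟩
    exact zigzag_isConnected fun A B => (Zigzag.of_hom (h A).some).trans (Zigzag.of_inv (h B).some)

/-- The canonical map `f^* 𝒪_S → 𝒪_T`. -/
def pullbackUnitHom : (Scheme.Modules.pullback f).obj (unitMod S) ⟶ unitMod T :=
  SheafOfModules.pullbackObjUnitToUnit f.toRingCatSheafHom

instance isIso_pullbackUnitHom : IsIso (pullbackUnitHom f) :=
  SheafOfModules.instIsIsoPullbackObjUnitToUnitOfFinal f.toRingCatSheafHom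

lemma pullbackUnitHom_app (a : Γ(S, ⊤)) :
    (pullbackUnitHom f).app ⊤ (pullbackSection f (M := unitMod S) a) = f.appTop a := by
  have h := SheafOfModules.pullbackPushforwardAdjunction_homEquiv_pullbackObjUnitToUnit
    f.toRingCatSheafHom
  rw [Adjunction.homEquiv_unit] at h
  have h2 := congrArg (fun ψ => Scheme.Modules.Hom.app (M := unitMod S)
    (N := (Scheme.Modules.pushforward f).obj (unitMod T)) ψ ⊤) h
  exact ConcreteCategory.congr_hom h2 a

lemma IsInvertible.pullback {L : S.Modules} (hL : IsInvertible L) :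
    IsInvertible ((Scheme.Modules.pullback f).obj L) := by
  intro x
  obtain ⟨U, hx, ⟨e⟩⟩ := hL (f x)
  refine ⟨f ⁻¹ᵁ U, hx, ⟨?_⟩⟩
  refine (Scheme.Modules.restrictFunctorIsoPullback (f ⁻¹ᵁ U).ι).app _ ≪≫
    (Scheme.Modules.pullbackComp (f ⁻¹ᵁ U).ι f).app L ≪≫
    (Scheme.Modules.pullbackCongr (morphismRestrict_ι f U).symm).app L ≪≫
    (Scheme.Modules.pullbackComp (f ∣_ U) U.ι).symm.app L ≪≫
    (Scheme.Modules.pullback (f ∣_ U)).mapIso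
      ((Scheme.Modules.restrictFunctorIsoPullback U.ι).symm.app L ≪≫ e) ≪≫ ?_
  exact asIso (pullbackUnitHom (f ∣_ U))

/-- Pullback of sections, on the tensor product of two modules of sections. -/
def pullbackTensor (M N : S.Modules) (U : S.Opens) :
    (tensorPre M N).presheaf.obj (.op U) →+
      (tensorPre ((Scheme.Modules.pullback f).obj M)
        ((Scheme.Modules.pullback f).obj N)).presheaf.obj (.op (f ⁻¹ᵁ U)) :=
  TensorProduct.liftAddHom (R := Γ(S, U)) (M := Γ(M, U)) (N := Γ(N, U))
    (P := TensorProduct Γ(T, f ⁻¹ᵁ U) Γ((Scheme.Modules.pullback f).obj M, f ⁻¹ᵁ U)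
      Γ((Scheme.Modules.pullback f).obj N, f ⁻¹ᵁ U))
    { toFun := fun a =>
        { toFun := fun b => pullbackSectionOn f U a ⊗ₜ pullbackSectionOn f U b
          map_zero' := by rw [map_zero, TensorProduct.tmul_zero]
          map_add' := fun b b' => by rw [map_add, TensorProduct.tmul_add] }
      map_zero' := by
        ext b
        exact (congrArg (· ⊗ₜ _) (map_zero _)).trans (TensorProduct.zero_tmul _ _)
      map_add' := fun a a' => by
        ext b
        exact (congrArg (· ⊗ₜ _) (map_add _ _ _)).trans (TensorProduct.add_tmul _ _ _) }
    (fun r a b => by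
      change pullbackSectionOn f U (r • a) ⊗ₜ pullbackSectionOn f U b =
        pullbackSectionOn f U a ⊗ₜ pullbackSectionOn f U (r • b)
      rw [pullbackSectionOn_smul, pullbackSectionOn_smul, TensorProduct.smul_tmul])

lemma pullbackTensor_tmul (M N : S.Modules) (U : S.Opens) (a : Γ(M, U)) (b : Γ(N, U)) :
    pullbackTensor f M N U (a ⊗ₜ[Γ(S, U)] b) =
      pullbackSectionOn f U a ⊗ₜ[Γ(T, f ⁻¹ᵁ U)] pullbackSectionOn f U b := rfl

lemma secMul_res {M N : S.Modules} {U W : S.Opens} (i : U ⟶ W) (a : Γ(M, W)) (b : Γ(N, W)) :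
    (tensor M N).presheaf.map i.op (secMul a b) =
      secMul (M.presheaf.map i.op a) (N.presheaf.map i.op b) :=
  (ConcreteCategory.congr_hom ((toTensor M N).naturality i.op) (a ⊗ₜ[Γ(S, W)] b)).symm

lemma secMul_pullback_res {M N : S.Modules} (a : Γ(M, ⊤)) (b : Γ(N, ⊤)) {U : S.Opens}
    (i : U ⟶ ⊤) :
    (tensor _ _).presheaf.map ((Opens.map f.base).map i).op
        (secMul (pullbackSection f a) (pullbackSection f b)) =
      (toTensor _ _).app (.op (f ⁻¹ᵁ U))
        (pullbackTensor f M N U ((tensorPre M N).presheaf.map i.op (a ⊗ₜ[Γ(S, ⊤)] b))) := by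
  refine (secMul_res _ _ _).trans ?_
  refine (congrArg₂ secMul (pullbackSectionOn_res f i a).symm
    (pullbackSectionOn_res f i b).symm).trans ?_
  rfl

lemma secMul_pullback {M N : S.Modules} {a c : Γ(M, ⊤)} {b d : Γ(N, ⊤)}
    (h : secMul a b = secMul c d) :
    secMul (pullbackSection f a) (pullbackSection f b) =
      secMul (pullbackSection f c) (pullbackSection f d) := by
  have h1 : Presheaf.equalizerSieve (F := (tensorPre M N).presheaf) (X := .op ⊤)
      (a ⊗ₜ[Γ(S, ⊤)] b) (c ⊗ₜ[Γ(S, ⊤)] d) ∈ Opens.grothendieckTopology S ⊤ :=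
    Presheaf.equalizerSieve_mem (Opens.grothendieckTopology S)
      (CategoryTheory.toSheafify (Opens.grothendieckTopology S) (tensorPre M N).presheaf) _ _ h
  choose U i hU hmem using fun x : T => h1 (f x) trivial
  refine TopCat.Sheaf.eq_of_locally_eq' ⟨_, Scheme.Modules.isSheaf _⟩ (fun x : T => f ⁻¹ᵁ U x) ⊤
    (fun x => homOfLE le_top) (fun x _ => Opens.mem_iSup.2 ⟨x, hmem x⟩) _ _ fun x => ?_
  refine (secMul_pullback_res f a b (i x)).trans (Eq.trans ?_ (secMul_pullback_res f c d (i x)).symm)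
  exact congrArg (fun z => (toTensor _ _).app (.op (f ⁻¹ᵁ U x)) (pullbackTensor f M N (U x) z)) (hU x)

/-- An invertible sheaf on the spectrum of a field is trivial. -/
lemma IsInvertible.nonempty_iso {K : CommRingCat.{u}} (hK : IsField K) {M : (Spec K).Modules}
    (hM : IsInvertible M) : Nonempty (M ≅ unitMod (Spec K)) := by
  let _ : Field K := hK.toField
  have hsub : Subsingleton (Spec K) := inferInstanceAs (Subsingleton (PrimeSpectrum K))
  obtain ⟨U, hU, ⟨e⟩⟩ := hM (IsLocalRing.closedPoint K)
  obtain rfl : U = ⊤ := top_le_iff.1 fun x _ => by rwa [hsub.elim x (IsLocalRing.closedPoint K)]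
  refine ⟨?_⟩
  refine (Scheme.Modules.pullbackId _).symm.app M ≪≫
    (Scheme.Modules.pullbackCongr ((Scheme.topIso (Spec K)).inv_hom_id).symm).app M ≪≫
    (Scheme.Modules.pullbackComp (Scheme.topIso (Spec K)).inv (⊤ : (Spec K).Opens).ι).symm.app M ≪≫
    (Scheme.Modules.pullback ((Scheme.topIso (Spec K)).inv)).mapIso
      ((Scheme.Modules.restrictFunctorIsoPullback _).symm.app M ≪≫ e) ≪≫
    asIso (pullbackUnitHom _)

lemma pullbackSection_ne_zero {K : CommRingCat.{u}} (hK : IsField K) {M : (Spec K).Modules}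
    (hM : IsInvertible M) {Y : Scheme.{u}} [Nonempty Y] (g : Y ⟶ Spec K) {a : Γ(M, ⊤)}
    (ha : a ≠ 0) : pullbackSection g a ≠ 0 := by
  obtain ⟨e⟩ := hM.nonempty_iso hK
  intro h0
  let c : Γ(Spec K, ⊤) := e.hom.app ⊤ a
  have hc : c ≠ 0 := by
    intro hc
    apply ha
    have : a = e.inv.app ⊤ (e.hom.app ⊤ a) := by
      rw [← ConcreteCategory.comp_apply, ← Scheme.Modules.Hom.comp_app, e.hom_inv_id]
      rfl
    rw [this]
    exact (congrArg (e.inv.app ⊤) hc).trans (map_zero _)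
  have h1 := pullbackSection_natural g e.hom a
  rw [h0, map_zero] at h1
  have h2 := pullbackUnitHom_app g c
  have h3 : g.appTop c = 0 := by
    rw [← h2]
    exact (congrArg ((pullbackUnitHom g).app ⊤) h1).trans (map_zero _)
  have hF : IsField Γ(Spec K, ⊤) :=
    (Scheme.ΓSpecIso K).commRingCatIsoToRingEquiv.toMulEquiv.isField hK
  obtain ⟨d, hd⟩ := hF.mul_inv_cancel hc
  have h4 : g.appTop (c * d) = 1 := by rw [hd, map_one]
  rw [map_mul, h3, zero_mul] at h4
  have : Nonempty (⊤ : Y.Opens) := ⟨⟨Classical.arbitrary Y, trivial⟩⟩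
  exact zero_ne_one h4

end Pullback

section Moduli

variable (F : Type u) [Field F] (V : Type u) [AddCommGroup V] [Module F V]

/-- Schemes over `F`. -/
abbrev SchemeOver : Type (u + 1) := Over (Spec (CommRingCat.of F))

variable {F} in
/-- The structure homomorphism `F → Γ(S, 𝒪_S)` of an `F`-scheme `S`. -/
def scalar (S : SchemeOver F) : F →+* Γ(S.left, ⊤) :=
  S.hom.appTop.hom.comp (Scheme.ΓSpecIso (CommRingCat.of F)).inv.hom

variable {F} in
lemma scalar_map {T S : SchemeOver F} (f : T ⟶ S) (a : F) :
    f.left.appTop (scalar S a) = scalar T a := by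
  have h := congrArg (fun φ => Scheme.Hom.appTop φ) (Over.w f)
  simp only [Scheme.Hom.comp_appTop] at h
  exact ConcreteCategory.congr_hom h ((Scheme.ΓSpecIso (CommRingCat.of F)).inv a)

/-- The nonzero vector `α v`. -/
def Nonzero.smul {F V : Type u} [Field F] [AddCommGroup V] [Module F V] (α : F) (hα : α ≠ 0)
    (v : Nonzero V) : Nonzero V :=
  ⟨α • v.1, smul_ne_zero hα v.2⟩

/-- A reciprocal map `ρ : V ∖ {0} → Γ(S, L)`. The two sides of the second condition are global
sections of `L ⊗ L`. -/
structure IsReciprocal {F V : Type u} [Field F] [AddCommGroup V] [Module F V]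
    (S : SchemeOver F) (L : S.left.Modules) (ρ : Nonzero V → Γ(L, ⊤)) : Prop where
  map_smul (α : F) (hα : α ≠ 0) (v : Nonzero V) :
    ρ (v.smul α hα) = scalar S α⁻¹ • ρ v
  map_add (v v' : Nonzero V) (h : v.1 + v'.1 ≠ 0) :
    secMul (ρ v) (ρ v') = secMul (ρ ⟨v.1 + v'.1, h⟩) (ρ v + ρ v')

/-- The map `φ : X → Γ(S, L)` is fiberwise non-zero: for every `s ∈ S` the composite of `φ` with
the restriction to the fiber `L ⊗ k(s)`, the pullback of `L` to `Spec k(s)`, is non-zero. -/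
def FiberwiseNonzero {S : Scheme.{u}} {L : S.Modules} {X : Type u} (φ : X → Γ(L, ⊤)) : Prop :=
  ∀ s : S, ∃ x : X, pullbackSection (S.fromSpecResidueField s) (φ x) ≠ 0

/-- The sheaf `L` is invertible and `ρ` is a fiberwise non-zero reciprocal map into its space of
global sections. -/
structure IsRecPair {F V : Type u} [Field F] [AddCommGroup V] [Module F V]
    (S : SchemeOver F) (L : S.left.Modules) (ρ : Nonzero V → Γ(L, ⊤)) : Prop where
  invertible : IsInvertible L
  reciprocal : IsReciprocal S L ρ
  fiberwiseNonzero : FiberwiseNonzero ρ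

/-- The pairs `(L, ρ)` of an invertible sheaf `L` on `S` and a fiberwise non-zero reciprocal map
`ρ : V ∖ {0} → Γ(S, L)`. -/
structure RecPair (S : SchemeOver F) : Type (u + 1) where
  sheaf : S.left.Modules
  map : Nonzero V → Γ(sheaf, ⊤)
  isRecPair : IsRecPair S sheaf map

variable {F V}

/-- Isomorphism of pairs. -/
instance RecPair.setoid (S : SchemeOver F) : Setoid (RecPair F V S) where
  r P Q := ∃ e : P.sheaf ≅ Q.sheaf, ∀ v, e.hom.app ⊤ (P.map v) = Q.map v
  iseqv :=
    { refl := fun P => ⟨Iso.refl _, fun _ => rfl⟩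
      symm := fun {P Q} ⟨e, he⟩ => ⟨e.symm, fun v => by
        rw [← he v, ← ConcreteCategory.comp_apply, Iso.symm_hom, ← Scheme.Modules.Hom.comp_app,
          e.hom_inv_id]
        rfl⟩
      trans := fun {P Q R} ⟨e, he⟩ ⟨e', he'⟩ => ⟨e ≪≫ e', fun v => by
        rw [← he' v, ← he v]
        rfl⟩ }

lemma IsRecPair.pullback {T S : SchemeOver F} (f : T ⟶ S) {L : S.left.Modules}
    {ρ : Nonzero V → Γ(L, ⊤)} (h : IsRecPair S L ρ) :
    IsRecPair T ((Scheme.Modules.pullback f.left).obj L) fun v => pullbackSection f.left (ρ v) where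
  invertible := h.invertible.pullback f.left
  reciprocal :=
    { map_smul := fun α hα v => by
        rw [h.reciprocal.map_smul]
        refine (pullbackSectionOn_smul f.left ⊤ _ _).trans ?_
        exact congrArg (· • _) (scalar_map f α⁻¹)
      map_add := fun v v' hv => by
        refine (secMul_pullback f.left (h.reciprocal.map_add v v' hv)).trans ?_
        exact congrArg (secMul _) (map_add (pullbackSectionOn f.left ⊤) _ _) }
  fiberwiseNonzero := fun t => by
    obtain ⟨v, hv⟩ := h.fiberwiseNonzero (f.left t)
    refine ⟨v, fun h0 => ?_⟩
    have h1 := pullbackSection_ne_zero (Field.toIsField _) (h.invertible.pullback _)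
      (Spec.map (f.left.residueFieldMap t)) hv
    rw [pullbackSection_comp] at h0 h1
    have h2 : ∀ {φ ψ : Spec (T.left.residueField t) ⟶ S.left}, φ = ψ →
        pullbackSection φ (ρ v) = 0 → pullbackSection ψ (ρ v) = 0 := by
      rintro φ _ rfl h; exact h
    have h3 : pullbackSection (T.left.fromSpecResidueField t ≫ f.left) (ρ v) = 0 := by
      have := congrArg (((Scheme.Modules.pullbackComp _ _).hom.app L).app ⊤) h0
      rw [← ConcreteCategory.comp_apply, ← Scheme.Modules.Hom.comp_app, Iso.inv_hom_id_app,
        map_zero] at this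
      exact this
    apply h1
    rw [h2 (Scheme.Hom.SpecMap_residueFieldMap_fromSpecResidueField _ _).symm h3, map_zero]

/-- The pullback of a pair under a morphism of `F`-schemes. -/
def RecPair.pullback {T S : SchemeOver F} (f : T ⟶ S) (P : RecPair F V S) : RecPair F V T where
  sheaf := (Scheme.Modules.pullback f.left).obj P.sheaf
  map v := pullbackSection f.left (P.map v)
  isRecPair := P.isRecPair.pullback f

variable (F V)

/-- The functor sending an `F`-scheme `S` to the set of isomorphism classes of pairs `(L, ρ)`. -/
def recFunctor : (SchemeOver F)ᵒᵖ ⥤ Type (u + 1) where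
  obj S := Quotient (RecPair.setoid (F := F) (V := V) S.unop)
  map {S T} f := ↾ (Quotient.map (RecPair.pullback f.unop) (by
    rintro P Q ⟨e, he⟩
    refine ⟨(Scheme.Modules.pullback f.unop.left).mapIso e, fun v => ?_⟩
    refine (pullbackSection_natural f.unop.left e.hom (P.map v)).symm.trans ?_
    rw [he v]
    rfl))
  map_id S := by
    ext P
    induction P using Quotient.inductionOn with | _ P =>
    refine Quotient.sound ⟨(Scheme.Modules.pullbackId S.unop.left).app P.sheaf, fun v => ?_⟩
    exact pullbackSection_id (P.map v)
  map_comp {S T R} f g := by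
    ext P
    induction P using Quotient.inductionOn with | _ P =>
    refine Quotient.sound ⟨((Scheme.Modules.pullbackComp g.unop.left f.unop.left).app P.sheaf).symm,
      fun v => ?_⟩
    exact (pullbackSection_comp g.unop.left f.unop.left (P.map v)).symm

/-- A reciprocal map `V ∖ {0} → B` into a commutative ring `B` with a homomorphism `F → B`. -/
structure IsReciprocalRing {F V : Type u} [Field F] [AddCommGroup V] [Module F V]
    {B : Type u} [CommRing B] (j : F →+* B) (ρ : Nonzero V → B) : Prop where
  map_smul (α : F) (hα : α ≠ 0) (v : Nonzero V) : ρ (v.smul α hα) = j α⁻¹ * ρ v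
  map_add (v v' : Nonzero V) (h : v.1 + v'.1 ≠ 0) :
    ρ v * ρ v' = ρ ⟨v.1 + v'.1, h⟩ * (ρ v + ρ v')

/-- The functor sending an `F`-scheme `S` to the set of all reciprocal maps
`V ∖ {0} → Γ(S, 𝒪_S)`. -/
def affineRecFunctor : (SchemeOver F)ᵒᵖ ⥤ Type u where
  obj S := {ρ : Nonzero V → Γ(S.unop.left, ⊤) // IsReciprocalRing (scalar S.unop) ρ}
  map {S T} f := ↾ fun ρ => ⟨fun v => f.unop.left.appTop (ρ.1 v),
    { map_smul := fun α hα v => by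
        rw [ρ.2.map_smul, map_mul]
        exact congrArg (· * _) (scalar_map f.unop α⁻¹)
      map_add := fun v v' h => by rw [← map_mul, ρ.2.map_add v v' h, map_mul, map_add] }⟩
  map_id S := by
    ext ρ v
    exact congrArg (fun φ : S.unop.left ⟶ S.unop.left => φ.appTop (ρ.1 v)) (Over.id_left _)
  map_comp {S T R} f g := by
    ext ρ v
    exact congrArg (fun φ : R.unop.left ⟶ S.unop.left => φ.appTop (ρ.1 v))
      (Over.comp_left _ _ _ _ _)

/-- `Q_V = Proj R_V`, as a scheme over `F`; the grading of `R_V` is inverted, so that the elements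
`1/v` have degree `1`. -/
def QV : SchemeOver F :=
  Over.mk (Y := Proj (gradeRV F V)) (Proj.toSpecZero (gradeRV F V) ≫
    Spec.map (CommRingCat.ofHom (algebraMap F (gradeRV F V 0))))

/-- The invertible sheaf `𝒪(1)` on `Q_V`. -/
def OOne : (QV F V).left.Modules := twist (gradeRV F V) 1

/-- The map `V ∖ {0} → Γ(Q_V, 𝒪(1))`, `v ↦ 1/v`. -/
def rhoV (v : Nonzero V) : Γ(OOne F V, ⊤) :=
  twistSection (gradeRV F V) 1
    ⟨recip F V v, by rw [gradeRV, pow_one]; exact Submodule.subset_span ⟨v, rfl⟩⟩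

/-- The affine cone `Spec R_V` over `Q_V`, as a scheme over `F`. -/
def coneQV : SchemeOver F :=
  Over.mk (Y := Spec (CommRingCat.of (RV F V)))
    (Spec.map (CommRingCat.ofHom (algebraMap F (RV F V))))

/-- The map `V ∖ {0} → R_V ≅ Γ(Spec R_V, 𝒪)`, `v ↦ 1/v`. -/
def rhoCone (v : Nonzero V) : Γ((coneQV F V).left, ⊤) :=
  (Scheme.ΓSpecIso (CommRingCat.of (RV F V))).inv (recip F V v)

end Moduli

end RecipMaps

end

open RecipMaps

noncomputable section

namespace RecipMaps

/-! ### The presentation of `R_V` -/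

/-! The heart of the matter is that the reciprocal relations are all the relations between the
elements `1/v`: any reciprocal map into a commutative `F`-algebra `B` comes from a homomorphism `R_V
→ B`.

To see this, let `A` be an algebra generated by the values of a reciprocal map `a`, with a
homomorphism `φ : A → K_V` sending `a v` to `1/v`. Then `φ` is injective, by induction along a basis
of `V`. When a vector `e` is added to a subspace `W`, the relation `a(x) a(y) = a(x - y) (a(y) -
a(x))` with `x = e + w`, `y = e + w'` breaks up every mixed product, so that the algebra of `W + Fe`
is spanned over that of `W` by `1` and the powers of the `a(e + w)`. Their images are `1` and the
powers of the `1/(e + w)`, which are linearly independent by uniqueness of partial fractions, since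
`e` is transcendental over the field generated by `W` (`linearIndependent_partialFractions`,
`IsReciprocalRing.injOn_adjoinOn_sup`). Applied to the subalgebra of `K_V × B` generated by the
pairs `(1/v, ρ v)`, this makes the first projection an isomorphism onto `R_V`, and the second
projection is the homomorphism sought (`IsReciprocalRing.exists_algHom`). The affine statement
follows because morphisms to an affine scheme are ring homomorphisms.

For `Proj`, a fiberwise non-zero family in an invertible sheaf is one of whose members is a
generator near each point (`fiberwiseNonzero_iff`). Where `ρ v` generates, the ratios `ρ w / ρ v`
form a reciprocal map into functions. It yields a homomorphism from `R_V` sending `1/v` to `1`,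
hence a morphism to the chart of `Proj` where `1/v` does not vanish. A morphism is determined by
these ratios (`HasCoords.unique`), so the local morphisms glue. The pullback of the twisting sheaf
has the same ratios as the given pair and is therefore isomorphic to it
(`exists_iso_of_sameCoords`); conversely, isomorphic pairs have equal ratios and so come from the
same morphism. -/

open Polynomial in
lemma linearIndependent_partialFractions {L K : Type*} [Field L] [Field K] [Algebra L K] {t : K}
    (ht : Transcendental L t) :
    LinearIndependent L fun i : Option (L × ℕ) =>
      i.elim 1 fun p => (t + algebraMap L K p.1)⁻¹ ^ (p.2 + 1) := by
  classical
  let _ : Algebra L[X] K := (aeval (R := L) t).toRingHom.toAlgebra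
  have hmap (p : L[X]) : algebraMap L[X] K p = aeval t p := rfl
  have : FaithfulSMul L[X] K := by
    rw [faithfulSMul_iff_algebraMap_injective]
    exact transcendental_iff_injective.1 ht
  have hne (w : L) : t + algebraMap L K w ≠ 0 := by
    intro h
    apply ht
    refine ⟨X + C w, X_add_C_ne_zero w, by simpa using h⟩
  rw [linearIndependent_iff]
  intro l hl
  let s : Finset L := l.support.eraseNone.image Prod.fst
  -- The index `n` stands for the exponent `n + 1`, and the indices that occur are all less than
  -- `N`.
  let N : ℕ := l.support.eraseNone.sup Prod.snd + 1
  have hsub : l.support ⊆ Finset.insertNone (s ×ˢ Finset.range N) := by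
    intro i hi
    rcases i with _ | p
    · simp
    · have hp : p ∈ l.support.eraseNone := by simpa using hi
      rw [Finset.some_mem_insertNone, Finset.mem_product]
      exact ⟨Finset.mem_image_of_mem _ hp, Finset.mem_range.2
        (Nat.lt_succ_of_le (Finset.le_sup (f := Prod.snd) hp))⟩
  rw [Finsupp.linearCombination_apply, Finsupp.sum_of_support_subset _ hsub _ (by simp),
    Finset.sum_insertNone, Finset.sum_product] at hl
  simp only [Option.elim_none, Option.elim_some] at hl
  -- Compare with the zero decomposition: the coefficients are admissible numerators, being
  -- constants over the linear polynomials `X + w`.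
  have key := quo_add_sum_rem_mul_pow_inverse_unique (R := L) (K := K) (s := s)
    (g := fun w => X + C w) (n := fun _ => N) (gi := fun w => (t + algebraMap L K w)⁻¹)
    (q₁ := C (l none)) (q₂ := 0) (r₁ := fun w j => C (l (some (w, j.1)))) (r₂ := fun _ _ => 0)
    (fun w _ => monic_X_add_C w)
    (fun w _ w' _ h => by
      have := (isCoprime_X_sub_C_of_isUnit_sub (R := L) (a := -w) (b := -w')
        (by rw [isUnit_iff_ne_zero]; intro h'; apply h; linear_combination -h'))
      simpa using this)
    (fun w _ => by rw [hmap]; simp [hne])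
    (fun w _ j => by rw [degree_X_add_C]; exact degree_C_le.trans_lt (by norm_num))
    (fun w _ j => by simp)
    (by
      simp only [hmap, aeval_C, map_zero, zero_mul, Finset.sum_const_zero, add_zero]
      rw [← hl, Algebra.smul_def, mul_one]
      congr 1
      refine Finset.sum_congr rfl fun w _ => ?_
      rw [Finset.sum_range fun j => l (some (w, j)) • (t + algebraMap L K w)⁻¹ ^ (j + 1)]
      simp only [Algebra.smul_def])
  ext i
  by_cases hi : i ∈ l.support
  · have hi' := hsub hi
    rcases i with _ | ⟨w, j⟩
    · simpa using key.1
    · rw [Finset.some_mem_insertNone, Finset.mem_product] at hi'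
      have := congrFun (key.2 w hi'.1) ⟨j, Finset.mem_range.1 hi'.2⟩
      simpa using this
  · simpa using hi

section Presentation

variable {F : Type u} [Field F] {V : Type u} [AddCommGroup V] [Module F V]
  {A K : Type u} [CommRing A] [Algebra F A] [Field K] [Algebra F K]

/-- The additive law for `x = e + w` and `-y = -(e + w')` reads `a(x) a(y) = a(x - y) (a(y) -
a(x))`, where `x - y` lies in `W`. Each use of it lowers the power of `a(y)` next to `a(x)` by one.
-/
lemma IsReciprocalRing.mul_pow_mem {a : Nonzero V → A} (ha : IsReciprocalRing (algebraMap F A) a)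
    {W : Submodule F V} {e : V} (he : ∀ w : W, e + w.1 ≠ 0)
    {B : Subalgebra F A} (hB : ∀ v : Nonzero V, v.1 ∈ W → a v ∈ B)
    (M : Submodule B A) (hM : ∀ (w : W) (n : ℕ), a ⟨e + w.1, he w⟩ ^ (n + 1) ∈ M)
    (w w' : W) (n : ℕ) : a ⟨e + w.1, he w⟩ * a ⟨e + w'.1, he w'⟩ ^ (n + 1) ∈ M := by
  by_cases hw : w = w'
  · subst hw
    rw [← pow_succ']
    exact hM w (n + 1)
  have hd : w.1 - w'.1 ≠ 0 := fun h => hw (Subtype.ext (sub_eq_zero.1 h))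
  have hrel : a ⟨e + w.1, he w⟩ * a ⟨e + w'.1, he w'⟩ =
      a ⟨w.1 - w'.1, hd⟩ * (a ⟨e + w'.1, he w'⟩ - a ⟨e + w.1, he w⟩) := by
    have h1 := ha.map_smul (-1) (neg_ne_zero.2 one_ne_zero) ⟨e + w'.1, he w'⟩
    rw [inv_neg_one, map_neg, map_one, neg_one_mul] at h1
    have hs : (e + w.1) + (-1 : F) • (e + w'.1) = w.1 - w'.1 := by
      rw [neg_one_smul]; abel
    have h2 := ha.map_add ⟨e + w.1, he w⟩
      (Nonzero.smul (-1 : F) (neg_ne_zero.2 one_ne_zero) ⟨e + w'.1, he w'⟩)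
      (by change (e + w.1) + (-1 : F) • (e + w'.1) ≠ 0; rwa [hs])
    have h3 : (⟨(e + w.1) + (-1 : F) • (e + w'.1), hs ▸ hd⟩ : Nonzero V) = ⟨w.1 - w'.1, hd⟩ :=
      Subtype.ext hs
    change _ = a ⟨(e + w.1) + (-1 : F) • (e + w'.1), _⟩ * _ at h2
    rw [h1, h3] at h2
    linear_combination -h2
  have hb : a ⟨w.1 - w'.1, hd⟩ ∈ B := hB _ (sub_mem w.2 w'.2)
  induction n with
  | zero =>
    rw [zero_add, pow_one, hrel]
    exact M.smul_mem (⟨_, hb⟩ : B) (sub_mem (by simpa using hM w' 0) (by simpa using hM w 0))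
  | succ n ih =>
    have : a ⟨e + w.1, he w⟩ * a ⟨e + w'.1, he w'⟩ ^ (n + 1 + 1) =
        a ⟨w.1 - w'.1, hd⟩ * (a ⟨e + w'.1, he w'⟩ ^ (n + 1 + 1) -
          a ⟨e + w.1, he w⟩ * a ⟨e + w'.1, he w'⟩ ^ (n + 1)) := by
      linear_combination a ⟨e + w'.1, he w'⟩ ^ (n + 1) * hrel
    rw [this]
    exact M.smul_mem (⟨_, hb⟩ : B) (sub_mem (hM w' (n + 1)) ih)

/-- The subalgebra generated by the values of `a` at the nonzero vectors of `W`. -/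
def adjoinOn (F : Type u) [Field F] [Module F V] [Algebra F A] (a : Nonzero V → A)
    (W : Submodule F V) : Subalgebra F A :=
  Algebra.adjoin F (a '' {v | v.1 ∈ W})

lemma mem_adjoinOn {a : Nonzero V → A} {W : Submodule F V} (v : Nonzero V) (hv : v.1 ∈ W) :
    a v ∈ adjoinOn F a W :=
  Algebra.subset_adjoin ⟨v, hv, rfl⟩

lemma IsReciprocalRing.adjoinOn_sup_le {a : Nonzero V → A}
    (ha : IsReciprocalRing (algebraMap F A) a) {W : Submodule F V} {e : V}
    (he : ∀ w : W, e + w.1 ≠ 0) (x : A) (hx : x ∈ adjoinOn F a (W ⊔ F ∙ e)) :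
    x ∈ Submodule.span (adjoinOn F a W) (Set.range fun i : Option (W × ℕ) =>
      i.elim 1 fun p => a ⟨e + p.1.1, he p.1⟩ ^ (p.2 + 1)) := by
  set M := Submodule.span (adjoinOn F a W) (Set.range fun i : Option (W × ℕ) =>
      i.elim 1 fun p => a ⟨e + p.1.1, he p.1⟩ ^ (p.2 + 1)) with hM
  have hM1 : (1 : A) ∈ M := Submodule.subset_span ⟨none, rfl⟩
  have hMp (w : W) (n : ℕ) : a ⟨e + w.1, he w⟩ ^ (n + 1) ∈ M :=
    Submodule.subset_span ⟨some (w, n), rfl⟩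
  have hgen (w : W) (y : A) (hy : y ∈ M) : a ⟨e + w.1, he w⟩ * y ∈ M := by
    induction hy using Submodule.span_induction with
    | mem y h =>
      obtain ⟨_ | ⟨w', n⟩, rfl⟩ := h
      · simpa using hMp w 0
      · exact ha.mul_pow_mem he (fun v hv => mem_adjoinOn v hv) M hMp w w' n
    | zero => simp
    | add x y _ _ hx hy => rw [mul_add]; exact add_mem hx hy
    | smul c x _ hx => rw [mul_smul_comm]; exact M.smul_mem c hx
  -- The span is not known to be a ring. The stronger claim that `x` maps it into itself passes to
  -- sums and products of the `x`.
  suffices h : ∀ y ∈ M, x * y ∈ M by simpa using h 1 hM1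
  rw [adjoinOn] at hx
  induction hx using Algebra.adjoin_induction with
  | mem x h =>
    obtain ⟨⟨v, hv0⟩, hv, rfl⟩ := h
    intro y hy
    obtain ⟨w, hw, z, hz, hvw⟩ := Submodule.mem_sup.1 hv
    obtain ⟨c, rfl⟩ := Submodule.mem_span_singleton.1 hz
    by_cases hc : c = 0
    · subst hc
      rw [zero_smul, add_zero] at hvw
      exact M.smul_mem (⟨_, mem_adjoinOn (F := F) ⟨v, hv0⟩ (hvw ▸ hw)⟩ : adjoinOn F a W) hy
    -- With `v = w + c e = c (e + c⁻¹ w)`, homogeneity reduces to a vector in which `e` has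
    -- coefficient `1`.
    · have h1 := ha.map_smul c hc ⟨e + c⁻¹ • w, he ⟨_, W.smul_mem c⁻¹ hw⟩⟩
      have h2 : Nonzero.smul c hc ⟨e + c⁻¹ • w, he ⟨_, W.smul_mem c⁻¹ hw⟩⟩ = (⟨v, hv0⟩ : Nonzero V) := by
        apply Subtype.ext
        change c • (e + c⁻¹ • w) = v
        rw [smul_add, smul_smul, mul_inv_cancel₀ hc, one_smul, add_comm]
        exact hvw
      rw [h2] at h1
      rw [h1, mul_assoc]
      exact M.smul_mem (⟨_, Subalgebra.algebraMap_mem _ _⟩ : adjoinOn F a W) (hgen ⟨_, W.smul_mem c⁻¹ hw⟩ y hy)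
  | algebraMap r =>
    exact fun y hy => M.smul_mem (⟨_, Subalgebra.algebraMap_mem _ r⟩ : adjoinOn F a W) hy
  | add x y _ _ hx hy => exact fun z hz => by rw [add_mul]; exact add_mem (hx z hz) (hy z hz)
  | mul x y _ _ hx hy => exact fun z hz => by rw [mul_assoc]; exact hx _ (hy z hz)

/-- Expand `x` in the spanning set of `adjoinOn_sup_le`. Applying `φ` turns this into a partial
fraction expansion in `τ e` with coefficients in `L`; if it vanishes, so does the image of each
coefficient, and `φ` is already injective on the coefficients. -/
lemma IsReciprocalRing.injOn_adjoinOn_sup {a : Nonzero V → A}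
    (ha : IsReciprocalRing (algebraMap F A) a) (φ : A →ₐ[F] K) {τ : V →ₗ[F] K}
    (hτ : Function.Injective τ) (hφ : ∀ v, φ (a v) = (τ v.1)⁻¹) {W : Submodule F V} {e : V}
    (L : IntermediateField F K) (hL : ∀ w ∈ W, τ w ∈ L) (he : Transcendental L (τ e))
    (h : ∀ x ∈ adjoinOn F a W, φ x = 0 → x = 0) :
    ∀ x ∈ adjoinOn F a (W ⊔ F ∙ e), φ x = 0 → x = 0 := by
  intro x hx hx0
  have heW (w : W) : e + w.1 ≠ 0 := by
    intro h0
    apply he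
    have : τ e = algebraMap L K ⟨τ (-w.1), hL _ (neg_mem w.2)⟩ := by
      change _ = τ (-w.1)
      rw [eq_neg_of_add_eq_zero_left h0]
    rw [this]
    exact isAlgebraic_algebraMap _
  have hmem (c : adjoinOn F a W) : φ c.1 ∈ L := by
    obtain ⟨c, hc⟩ := c
    have : adjoinOn F a W ≤ L.toSubalgebra.comap φ := by
      refine Algebra.adjoin_le ?_
      rintro _ ⟨v, hv, rfl⟩
      change φ (a v) ∈ L
      rw [hφ]
      exact inv_mem (hL _ hv)
    exact this hc
  have h1 := ha.adjoinOn_sup_le heW x hx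
  rw [Finsupp.mem_span_range_iff_exists_finsupp] at h1
  obtain ⟨c, rfl⟩ := h1
  -- Poles are indexed by `W` rather than by `L`; distinct vectors give distinct poles because `τ`
  -- is injective.
  have hLI := (linearIndependent_partialFractions he).comp
    (Option.map fun p : W × ℕ => ((⟨τ p.1.1, hL _ p.1.2⟩ : L), p.2)) (by
      apply Option.map_injective
      rintro ⟨w, n⟩ ⟨w', n'⟩ h
      simp only [Prod.mk.injEq, Subtype.mk.injEq] at h
      obtain ⟨h1, rfl⟩ := h
      rw [Subtype.ext (hτ h1)])
  rw [linearIndependent_iff'] at hLI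
  have h2 := hLI c.support (fun i => ⟨φ (c i).1, hmem (c i)⟩) (by
    rw [← hx0, Finsupp.sum, map_sum]
    refine Finset.sum_congr rfl fun i _ => ?_
    rw [Algebra.smul_def (c i), map_mul, Algebra.smul_def]
    refine congrArg (φ (c i).1 * ·) ?_
    rcases i with _ | ⟨w, n⟩
    · exact (map_one φ).symm
    · refine Eq.trans ?_ (map_pow φ _ _).symm
      rw [hφ]
      change (τ e + τ w.1)⁻¹ ^ (n + 1) = _
      rw [← _root_.map_add])
  refine Finset.sum_eq_zero fun i hi => ?_
  have h3 := h _ (c i).2 (congrArg Subtype.val (h2 i hi))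
  exact (Algebra.smul_def _ _).trans ((congrArg (· * _) h3).trans (zero_mul _))

lemma algebraicIndependent_toKV {ι : Type*} (b : Module.Basis ι F V) :
    AlgebraicIndependent F fun i => toKV F V (b i) := by
  have h : MvPolynomial.aeval (R := F) (fun i => toKV F V (b i)) =
      (IsScalarTower.toAlgHom F (SymmetricAlgebra F V) (KV F V)).comp
        (SymmetricAlgebra.equivMvPolynomial b).symm.toAlgHom := by
    ext i
    simp [toKV]
  rw [AlgebraicIndependent, h]
  exact (IsFractionRing.injective (SymmetricAlgebra F V) (KV F V)).comp
    (SymmetricAlgebra.equivMvPolynomial b).symm.injective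

variable (F V) in
/-- The canonical map `V → K_V`, as a linear map. -/
def toKVLinear : V →ₗ[F] KV F V where
  toFun := toKV F V
  map_add' a b := by simp [toKV]
  map_smul' c a := by
    simp [toKV, Algebra.smul_def, ← IsScalarTower.algebraMap_apply]

lemma toKVLinear_injective : Function.Injective (toKVLinear F V) := by
  let b := Module.Basis.ofVectorSpace F V
  have h := linearIndependent_iff.1 (algebraicIndependent_toKV b).linearIndependent
  rw [injective_iff_map_eq_zero]
  intro x hx
  rw [← b.repr.map_eq_zero_iff]
  apply h
  conv_rhs => rw [← hx, ← b.linearCombination_repr x]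
  rw [Finsupp.linearCombination_apply, Finsupp.linearCombination_apply, map_finsuppSum]
  simp only [map_smul]
  rfl

open scoped IntermediateField.algebraAdjoinAdjoin in
lemma transcendental_intermediateField_adjoin {E : Type*} [Field E] [Algebra F E] {s : Set E} {x : E}
    (h : Transcendental (Algebra.adjoin F s) x) :
    Transcendental (IntermediateField.adjoin F s) x := fun h' =>
  h ((IsFractionRing.isAlgebraic_iff (Algebra.adjoin F s) (IntermediateField.adjoin F s) E).2 h')

/-- Basis vectors are added one at a time, each transcendental over the field generated by the
preceding ones. The induction starts at the zero subspace, whose algebra is the image of `F`. -/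
lemma IsReciprocalRing.injective_of_adjoin_eq_top [FiniteDimensional F V] {a : Nonzero V → A}
    (ha : IsReciprocalRing (algebraMap F A) a) (φ : A →ₐ[F] KV F V)
    (hφ : ∀ v, φ (a v) = (toKV F V v.1)⁻¹) (htop : Algebra.adjoin F (Set.range a) = ⊤) :
    Function.Injective φ := by
  classical
  let b := Module.finBasis F V
  have key (s : Finset (Fin (Module.finrank F V))) :
      ∀ x ∈ adjoinOn F a (Submodule.span F (b '' s)), φ x = 0 → x = 0 := by
    induction s using Finset.induction_on with
    | empty =>
      intro x hx hx0
      have : a '' {v | v.1 ∈ Submodule.span F (b '' (∅ : Finset (Fin (Module.finrank F V))))} = ∅ := by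
        rw [Set.image_eq_empty, Set.eq_empty_iff_forall_notMem]
        intro v hv
        exact v.2 (by simpa using hv)
      rw [adjoinOn, this, Algebra.adjoin_empty, Algebra.mem_bot] at hx
      obtain ⟨r, rfl⟩ := hx
      rw [AlgHom.commutes, map_eq_zero] at hx0
      rw [hx0, map_zero]
    | insert i s hi ih =>
      rw [Finset.coe_insert, Set.image_insert_eq, Submodule.span_insert, sup_comm]
      refine ha.injOn_adjoinOn_sup φ toKVLinear_injective hφ
        (IntermediateField.adjoin F ((fun i => toKV F V (b i)) '' s)) (fun w hw => ?_)
        (transcendental_intermediateField_adjoin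
          ((algebraicIndependent_toKV b).transcendental_adjoin (by simpa using hi))) ih
      induction hw using Submodule.span_induction with
      | mem x h =>
        obtain ⟨j, hj, rfl⟩ := h
        exact IntermediateField.subset_adjoin _ _ ⟨j, hj, rfl⟩
      | zero => rw [map_zero]; exact zero_mem _
      | add x y _ _ hx hy => rw [_root_.map_add]; exact add_mem hx hy
      | smul c x _ hx => rw [_root_.map_smul]; exact IntermediateField.smul_mem _ hx
  rw [injective_iff_map_eq_zero]
  intro x
  refine key Finset.univ x ?_
  rw [Finset.coe_univ, Set.image_univ, b.span_eq, adjoinOn]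
  simp [htop]

end Presentation

/-! ### The universal property of `R_V` -/

section Universal

variable {F : Type u} [Field F] {V : Type u} [AddCommGroup V] [Module F V]

lemma toKV_ne_zero (v : Nonzero V) : toKV F V v.1 ≠ 0 := fun h =>
  v.2 (toKVLinear_injective (F := F) (h.trans (map_zero (toKVLinear F V)).symm))

lemma toKV_smul (c : F) (v : V) : toKV F V (c • v) = algebraMap F _ c * toKV F V v :=
  ((toKVLinear F V).map_smul c v).trans (Algebra.smul_def _ _)

lemma toKV_add (v w : V) : toKV F V (v + w) = toKV F V v + toKV F V w :=
  (toKVLinear F V).map_add v w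

lemma isReciprocalRing_inv_toKV :
    IsReciprocalRing (algebraMap F (KV F V)) fun v : Nonzero V => (toKV F V v.1)⁻¹ where
  map_smul α hα v := by
    change (toKV F V (α • v.1))⁻¹ = _
    rw [toKV_smul, mul_inv, map_inv₀]
  map_add v w h := by
    have h1 := toKV_ne_zero (F := F) v
    have h2 := toKV_ne_zero (F := F) w
    have h3 := toKV_ne_zero (F := F) ⟨v.1 + w.1, h⟩
    simp only [toKV_add] at h3 ⊢
    field_simp
    ring

lemma isReciprocalRing_recip : IsReciprocalRing (algebraMap F (RV F V)) (recip F V) where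
  map_smul α hα v := Subtype.ext (isReciprocalRing_inv_toKV.map_smul α hα v)
  map_add v w h := Subtype.ext (isReciprocalRing_inv_toKV.map_add v w h)

lemma adjoin_range_recip : Algebra.adjoin F (Set.range (recip F V)) = ⊤ := by
  refine Eq.trans (congrArg (Algebra.adjoin F) ?_) (Algebra.adjoin_adjoin_coe_preimage (R := F)
    (s := Set.range fun v : Nonzero V => (toKV F V v.1)⁻¹))
  ext x
  exact ⟨fun ⟨v, h⟩ => ⟨v, congrArg Subtype.val h⟩, fun ⟨v, h⟩ => ⟨v, Subtype.ext h⟩⟩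

lemma RV_algHom_ext {B : Type*} [Semiring B] [Algebra F B] {f g : RV F V →ₐ[F] B}
    (h : ∀ v, f (recip F V v) = g (recip F V v)) : f = g :=
  AlgHom.ext_of_adjoin_eq_top adjoin_range_recip (by rintro _ ⟨v, rfl⟩; exact h v)

/-- The ring `R_V` is the universal target of a reciprocal map. -/
lemma IsReciprocalRing.exists_algHom [FiniteDimensional F V] {B : Type u} [CommRing B] [Algebra F B]
    {ρ : Nonzero V → B} (hρ : IsReciprocalRing (algebraMap F B) ρ) :
    ∃ f : RV F V →ₐ[F] B, ∀ v, f (recip F V v) = ρ v := by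
  -- The generated subalgebra `A` is the graph of the homomorphism to be found: once its projection
  -- to `K_V` is injective, it is a function on `R_V`.
  let s : Set (KV F V × B) := Set.range fun v : Nonzero V => ((toKV F V v.1)⁻¹, ρ v)
  let A := Algebra.adjoin F s
  let a : Nonzero V → A := fun v => ⟨((toKV F V v.1)⁻¹, ρ v), Algebra.subset_adjoin ⟨v, rfl⟩⟩
  have ha : IsReciprocalRing (algebraMap F A) a :=
    { map_smul := fun α hα v => Subtype.ext (Prod.ext
        (isReciprocalRing_inv_toKV.map_smul α hα v) (hρ.map_smul α hα v))
      map_add := fun v w h => Subtype.ext (Prod.ext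
        (isReciprocalRing_inv_toKV.map_add v w h) (hρ.map_add v w h)) }
  let φ : A →ₐ[F] KV F V := (AlgHom.fst F (KV F V) B).comp A.val
  have htop : Algebra.adjoin F (Set.range a) = ⊤ := by
    rw [← Algebra.adjoin_adjoin_coe_preimage (R := F) (s := s)]
    congr 1
    ext x
    exact ⟨fun ⟨v, h⟩ => ⟨v, congrArg Subtype.val h⟩, fun ⟨v, h⟩ => ⟨v, Subtype.ext h⟩⟩
  have hinj := ha.injective_of_adjoin_eq_top φ (fun v => rfl) htop
  have hrange : φ.range = RV F V := by
    rw [← Algebra.map_top, ← htop, AlgHom.map_adjoin, ← Set.range_comp]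
    rfl
  let e := (AlgEquiv.ofInjective φ hinj).trans (Subalgebra.equivOfEq _ _ hrange)
  refine ⟨((AlgHom.snd F (KV F V) B).comp A.val).comp e.symm.toAlgHom, fun v => ?_⟩
  have : e.symm (recip F V v) = a v := by
    rw [AlgEquiv.symm_apply_eq]
    rfl
  change (AlgHom.snd F (KV F V) B) (e.symm (recip F V v)).1 = ρ v
  rw [this]
  rfl

end Universal

/-! ### The affine cone -/

/-- A universal element represents a functor. -/
lemma exists_representableBy {C : Type*} [Category C] {G : Cᵒᵖ ⥤ Type*} {Y : C} (u : G.obj (op Y))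
    (h : ∀ X, Function.Bijective fun f : X ⟶ Y => G.map f.op u) :
    ∃ e : G.RepresentableBy Y, e.homEquiv (𝟙 Y) = u :=
  ⟨{ homEquiv := fun {X} => Equiv.ofBijective _ (h X)
     homEquiv_comp := fun f g => by simp }, by simp⟩

section Cone

variable (F : Type u) [Field F] (V : Type u) [AddCommGroup V] [Module F V]

/-- The isomorphism `R_V ≅ Γ(Spec R_V, 𝒪)`. -/
def coneIso : CommRingCat.of (RV F V) ≅ Γ((coneQV F V).left, ⊤) :=
  (Scheme.ΓSpecIso (CommRingCat.of (RV F V))).symm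

lemma scalar_coneQV (c : F) :
    scalar (coneQV F V) c = (coneIso F V).hom.hom (algebraMap F (RV F V) c) :=
  (ConcreteCategory.congr_hom (Scheme.ΓSpecIso_inv_naturality
    (CommRingCat.ofHom (algebraMap F (RV F V)))) c).symm

lemma IsReciprocalRing.map {F V : Type u} [Field F] [AddCommGroup V] [Module F V] {B C : Type u}
    [CommRing B] [CommRing C] {j : F →+* B} {k : F →+* C} {ρ : Nonzero V → B}
    (h : IsReciprocalRing j ρ) (g : B →+* C) (hg : ∀ c, g (j c) = k c) :
    IsReciprocalRing k fun v => g (ρ v) where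
  map_smul α hα v := by rw [h.map_smul, map_mul, hg]
  map_add v w hvw := by rw [← map_mul, h.map_add v w hvw, map_mul, _root_.map_add]

lemma isReciprocalRing_rhoCone : IsReciprocalRing (scalar (coneQV F V)) (rhoCone F V) :=
by
  have h := (isReciprocalRing_recip (F := F) (V := V)).map (C := Γ((coneQV F V).left, ⊤))
    (k := scalar (coneQV F V)) (coneIso F V).hom.hom fun c => (scalar_coneQV F V c).symm
  have h2 : rhoCone F V = fun v => (coneIso F V).hom.hom (recip F V v) := rfl
  rw [h2]
  exact h

variable {F V}

/-- A morphism of `F`-schemes to the cone is determined by its values on the `1/v`. -/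
lemma coneQV_hom_ext {S : SchemeOver F} {f g : S ⟶ coneQV F V}
    (h : ∀ v, f.left.appTop (rhoCone F V v) = g.left.appTop (rhoCone F V v)) : f = g := by
  let _ : Algebra F Γ(S.left, ⊤) := (scalar S).toAlgebra
  let toAlg (f : S ⟶ coneQV F V) : RV F V →ₐ[F] Γ(S.left, ⊤) :=
    { ((coneIso F V).hom ≫ f.left.appTop).hom with
      commutes' := fun c => by
        refine Eq.trans ?_ (scalar_map f c)
        exact congrArg (f.left.appTop) (scalar_coneQV F V c).symm }
  have h1 : toAlg f = toAlg g := RV_algHom_ext h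
  refine Over.OverMorphism.ext ?_
  have : IsAffine (coneQV F V).left := inferInstanceAs (IsAffine (Spec _))
  refine ext_of_isAffine ?_
  rw [← cancel_epi (coneIso F V).hom]
  ext r
  exact congrArg (fun φ : RV F V →ₐ[F] Γ(S.left, ⊤) => φ r) h1

lemma exists_hom_coneQV [FiniteDimensional F V] {S : SchemeOver F} {ρ : Nonzero V → Γ(S.left, ⊤)}
    (hρ : IsReciprocalRing (scalar S) ρ) :
    ∃ f : S ⟶ coneQV F V, ∀ v, f.left.appTop (rhoCone F V v) = ρ v := by
  let _ : Algebra F Γ(S.left, ⊤) := (scalar S).toAlgebra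
  obtain ⟨g, hg⟩ := IsReciprocalRing.exists_algHom (B := Γ(S.left, ⊤)) hρ
  let φ : S.left ⟶ (coneQV F V).left :=
    S.left.toSpecΓ ≫ Spec.map (CommRingCat.ofHom g.toRingHom)
  have hφ : (coneIso F V).hom ≫ φ.appTop = CommRingCat.ofHom g.toRingHom := by
    have h1 : φ.appTop = (Spec.map (CommRingCat.ofHom g.toRingHom)).appTop ≫
        (Scheme.ΓSpecIso Γ(S.left, ⊤)).hom := by
      rw [← Scheme.toSpecΓ_appTop]
      rfl
    rw [h1]
    change (Scheme.ΓSpecIso (CommRingCat.of (RV F V))).inv ≫ _ = _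
    rw [Scheme.ΓSpecIso_naturality, Iso.inv_hom_id_assoc]
  refine ⟨Over.homMk φ ?_, fun v => ?_⟩
  · refine ext_of_isAffine ?_
    rw [← cancel_epi (Scheme.ΓSpecIso (CommRingCat.of F)).inv]
    ext c
    have h1 : (coneQV F V).hom.appTop ((Scheme.ΓSpecIso (CommRingCat.of F)).inv c) = _ :=
      scalar_coneQV F V c
    change φ.appTop ((coneQV F V).hom.appTop ((Scheme.ΓSpecIso (CommRingCat.of F)).inv c)) = _
    rw [h1]
    exact (ConcreteCategory.congr_hom hφ (algebraMap F (RV F V) c)).trans (g.commutes c)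
  · exact (ConcreteCategory.congr_hom hφ (recip F V v)).trans (hg v)

lemma coneQV_represents (F : Type u) [Field F] (V : Type u) [AddCommGroup V] [Module F V]
    [FiniteDimensional F V] :
    ∃ (h : IsReciprocalRing (scalar (coneQV F V)) (rhoCone F V))
      (e : (affineRecFunctor F V).RepresentableBy (coneQV F V)),
      e.homEquiv (𝟙 (coneQV F V)) = ⟨rhoCone F V, h⟩ := by
  refine ⟨isReciprocalRing_rhoCone F V, exists_representableBy _ fun S => ⟨fun f g h => ?_, ?_⟩⟩
  · exact coneQV_hom_ext fun v => congrFun (congrArg Subtype.val h) v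
  · rintro ⟨ρ, hρ⟩
    obtain ⟨f, hf⟩ := exists_hom_coneQV hρ
    exact ⟨f, Subtype.ext (funext hf)⟩

end Cone

/-! ### Generators of sheaves of modules -/

section Generators

variable {S T : Scheme.{u}} {L M N : S.Modules}

/-- Restriction of sections of a module. -/
def resM {U : S.Opens} (a : Γ(L, U)) {W : S.Opens} (h : W ≤ U) : Γ(L, W) :=
  L.presheaf.map (homOfLE h).op a

/-- Restriction of functions. -/
def resO {U : S.Opens} (r : Γ(S, U)) {W : S.Opens} (h : W ≤ U) : Γ(S, W) :=
  S.presheaf.map (homOfLE h).op r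

variable {U W W' : S.Opens}

lemma resM_resM (a : Γ(L, U)) (h : W ≤ U) (h' : W' ≤ W) :
    resM (resM a h) h' = resM a (h'.trans h) := by
  simp only [resM, ← ConcreteCategory.comp_apply, ← Functor.map_comp]
  rfl

lemma resM_self (a : Γ(L, U)) (h : U ≤ U) : resM a h = a := by
  have : (homOfLE h).op = 𝟙 (op U) := rfl
  rw [resM, this, L.presheaf.map_id]
  rfl

lemma resM_smul (r : Γ(S, U)) (a : Γ(L, U)) (h : W ≤ U) :
    resM (r • a) h = resO r h • resM a h :=
  Scheme.Modules.map_smul L (homOfLE h) r a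

lemma resM_add (a b : Γ(L, U)) (h : W ≤ U) : resM (a + b) h = resM a h + resM b h :=
  map_add _ _ _

lemma resM_zero (h : W ≤ U) : resM (0 : Γ(L, U)) h = 0 := map_zero _

lemma resM_app (φ : L ⟶ M) (a : Γ(L, U)) (h : W ≤ U) :
    resM (φ.app U a) h = φ.app W (resM a h) :=
  (ConcreteCategory.congr_hom (φ.mapPresheaf.naturality (homOfLE h).op) a).symm

lemma resO_self (r : Γ(S, U)) (h : U ≤ U) : resO r h = r := by
  have : (homOfLE h).op = 𝟙 (op U) := rfl
  rw [resO, this, S.presheaf.map_id]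
  rfl

lemma resO_mul (r s : Γ(S, U)) (h : W ≤ U) : resO (r * s) h = resO r h * resO s h := map_mul _ _ _
lemma resO_one (h : W ≤ U) : resO (1 : Γ(S, U)) h = 1 := map_one _

lemma resM_ext {a b : Γ(L, U)} (h : ∀ x ∈ U, ∃ (W : S.Opens) (hW : W ≤ U), x ∈ W ∧
    resM a hW = resM b hW) : a = b := by
  choose! W hW hx hab using h
  refine TopCat.Sheaf.eq_of_locally_eq' ⟨_, Scheme.Modules.isSheaf L⟩ (fun x : U => W x.1) U
    (fun x => homOfLE (hW x.1 x.2)) (fun x hxU => Opens.mem_iSup.2 ⟨⟨x, hxU⟩, hx x hxU⟩) _ _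
    fun x => hab x.1 x.2

lemma resO_ext {a b : Γ(S, U)} (h : ∀ x ∈ U, ∃ (W : S.Opens) (hW : W ≤ U), x ∈ W ∧
    resO a hW = resO b hW) : a = b := by
  choose! W hW hx hab using h
  refine TopCat.Sheaf.eq_of_locally_eq' S.sheaf (fun x : U => W x.1) U
    (fun x => homOfLE (hW x.1 x.2)) (fun x hxU => Opens.mem_iSup.2 ⟨⟨x, hxU⟩, hx x hxU⟩) _ _
    fun x => hab x.1 x.2

lemma resM_glue (W : U → S.Opens) (hW : ∀ x, W x ≤ U) (hx : ∀ x : U, x.1 ∈ W x)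
    (a : ∀ x, Γ(L, W x)) (h : ∀ x y, resM (a x) (inf_le_left : W x ⊓ W y ≤ W x) =
      resM (a y) (inf_le_right : W x ⊓ W y ≤ W y)) :
    ∃ b : Γ(L, U), ∀ x, resM b (hW x) = a x := by
  obtain ⟨b, hb, -⟩ := TopCat.Sheaf.existsUnique_gluing' ⟨L.presheaf, Scheme.Modules.isSheaf L⟩
    W U (fun x => homOfLE (hW x)) (fun x hxU => Opens.mem_iSup.2 ⟨⟨x, hxU⟩, hx ⟨x, hxU⟩⟩)
    a (fun x y => h x y)
  exact ⟨b, hb⟩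

/-- The section `a` of `L` over `U` generates `L` freely over `U`. -/
def IsGen (a : Γ(L, U)) : Prop :=
  ∀ (W : S.Opens) (h : W ≤ U), Function.Bijective fun r : Γ(S, W) => r • resM a h

lemma IsGen.bijective {a : Γ(L, U)} (ha : IsGen a) : Function.Bijective fun r : Γ(S, U) => r • a := by
  simpa only [resM_self] using ha U le_rfl

lemma IsGen.smul_injective {a : Γ(L, U)} (ha : IsGen a) {r s : Γ(S, U)} (h : r • a = s • a) : r = s :=
  ha.bijective.1 h

lemma IsGen.exists_smul {a : Γ(L, U)} (ha : IsGen a) (b : Γ(L, U)) : ∃ r : Γ(S, U), b = r • a :=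
  (ha.bijective.2 b).imp fun _ h => h.symm

lemma IsGen.res {a : Γ(L, U)} (ha : IsGen a) (h : W ≤ U) : IsGen (resM a h) := fun W' h' => by
  simpa only [resM_resM] using ha W' (h'.trans h)

lemma IsGen.app {a : Γ(L, U)} (ha : IsGen a) (e : L ≅ M) : IsGen (e.hom.app U a) := by
  intro W h
  have h1 : Function.Bijective (e.hom.app W) :=
    (ConcreteCategory.isIso_iff_bijective (e.hom.app W)).1 inferInstance
  have h2 : (fun r : Γ(S, W) => r • resM (e.hom.app U a) h) =
      (e.hom.app W) ∘ fun r : Γ(S, W) => r • resM a h := by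
    ext r
    rw [resM_app, Function.comp_apply, Scheme.Modules.Hom.app_smul]
  rw [h2]
  exact h1.comp (ha W h)

lemma app_inv_app (e : L ≅ M) (a : Γ(M, U)) : e.hom.app U (e.inv.app U a) = a := by
  rw [← ConcreteCategory.comp_apply, ← Scheme.Modules.Hom.comp_app, e.inv_hom_id]
  rfl

lemma inv_app_app (e : L ≅ M) (a : Γ(L, U)) : e.inv.app U (e.hom.app U a) = a :=
  app_inv_app e.symm a

lemma isGen_app_iff {a : Γ(L, U)} (e : L ≅ M) : IsGen (e.hom.app U a) ↔ IsGen a :=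
  ⟨fun h => by simpa only [Iso.symm_hom, inv_app_app] using h.app e.symm, fun h => h.app e⟩

lemma IsGen.smul {a : Γ(L, U)} (ha : IsGen a) {r : Γ(S, U)} (hr : IsUnit r) : IsGen (r • a) := by
  intro W h
  have h1 : IsUnit (resO r h) := hr.map (S.presheaf.map (homOfLE h).op).hom
  have h2 : (fun s : Γ(S, W) => s • resM (r • a) h) =
      (fun s : Γ(S, W) => s • resM a h) ∘ fun s => s * resO r h := by
    ext s
    simp only [resM_smul, Function.comp_apply, mul_smul]
  rw [h2]
  exact (ha W h).comp (IsUnit.isUnit_iff_mulRight_bijective.1 h1)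

lemma IsGen.isUnit_of_smul {a : Γ(L, U)} (ha : IsGen a) {r : Γ(S, U)} (h : IsGen (r • a)) :
    IsUnit r := by
  obtain ⟨s, hs⟩ := h.exists_smul a
  have : s * r = 1 := ha.smul_injective (by rw [mul_smul, one_smul, ← hs])
  exact IsUnit.of_mul_eq_one s (by rw [mul_comm, this])

/-- The function `1`, as a section of the structure sheaf as a module. -/
def unitSection (S : Scheme.{u}) (U : S.Opens) : Γ(unitMod S, U) := (1 : Γ(S, U))

lemma isGen_unitSection : IsGen (unitSection S U) := by
  intro W h
  have h1 : resM (unitSection S U) h = unitSection S W := resO_one h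
  have h2 : (fun r : Γ(S, W) => r • resM (unitSection S U) h) = fun r : Γ(S, W) => r := by
    ext r
    rw [h1]
    exact mul_one r
  rw [h2]
  exact Function.bijective_id

/-- The homomorphism `𝒪_S → L` defined by a global section of `L`. -/
def unitHom (a : Γ(L, ⊤)) : unitMod S ⟶ L :=
  ⟨{ app := fun U => ModuleCat.ofHom (X := (unitMod S).val.obj U) (Y := L.val.obj U)
      (LinearMap.toSpanSingleton Γ(S, U.unop) Γ(L, U.unop) (resM a le_top))
     naturality := fun {U W} i => by
      refine ModuleCat.hom_ext (LinearMap.ext fun (r : Γ(S, U.unop)) => ?_)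
      have h := resM_smul r (resM a (le_top : U.unop ≤ ⊤)) i.unop.le
      rw [resM_resM] at h
      exact h.symm }⟩

lemma unitHom_app (a : Γ(L, ⊤)) (r : Γ(S, U)) : (unitHom a).app U r = r • resM a le_top := rfl

/-- An `𝒪_S`-module with a generating global section is trivial. -/
lemma IsGen.exists_iso {a : Γ(L, ⊤)} (ha : IsGen a) :
    ∃ e : unitMod S ≅ L, e.hom.app ⊤ (unitSection S ⊤) = a := by
  have : IsIso (unitHom a) := by
    rw [Scheme.Modules.Hom.isIso_iff_isIso_app]
    intro U
    exact (ConcreteCategory.isIso_iff_bijective _).2 (ha U le_top)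
  refine ⟨asIso (unitHom a), ?_⟩
  have h := unitHom_app a (1 : Γ(S, ⊤))
  rw [one_smul, resM_self] at h
  exact h


/-- The open subsets of `f ''ᵁ U` are the images of the open subsets of `U`, and `appIso` identifies
the functions on them. -/
lemma isGen_restrict_iff {X Y : Scheme.{u}} (f : X ⟶ Y) [IsOpenImmersion f] (M : Y.Modules)
    {U : X.Opens} (a : Γ(M, f ''ᵁ U)) :
    IsGen (L := M.restrict f) (U := U) a ↔ IsGen (L := M) (U := f ''ᵁ U) a := by
  have key (W : X.Opens) (h : W ≤ U) :
      (Function.Bijective fun r : Γ(X, W) => r • resM (L := M.restrict f) (U := U) a h) ↔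
      Function.Bijective fun r : Γ(Y, f ''ᵁ W) =>
        r • resM (L := M) (U := f ''ᵁ U) a (f.image_mono h) := by
    have h1 : Function.Bijective (f.appIso W).inv :=
      (ConcreteCategory.isIso_iff_bijective (f.appIso W).inv).1 inferInstance
    have h2 : (fun r : Γ(X, W) => r • resM (L := M.restrict f) (U := U) a h) =
        (fun r : Γ(Y, f ''ᵁ W) => r • resM (L := M) (U := f ''ᵁ U) a (f.image_mono h)) ∘
          (f.appIso W).inv := rfl
    rw [h2]
    exact Function.Bijective.of_comp_iff _ h1
  constructor
  · intro ha W hW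
    obtain ⟨W, hWU, rfl⟩ : ∃ W' : X.Opens, W' ≤ U ∧ f ''ᵁ W' = W := by
      refine ⟨f ⁻¹ᵁ W, ?_, ?_⟩
      · rw [← f.preimage_image_eq U]
        exact f.preimage_mono hW
      · rw [f.image_preimage_eq_opensRange_inf]
        exact inf_eq_right.2 (hW.trans (f.image_le_opensRange U))
    exact (key W hWU).1 (ha W hWU)
  · exact fun ha W hW => (key W hW).2 (ha _ (f.image_mono hW))

/-- A trivialization is the same as the section corresponding to `1`. This form allows all later
arguments to be made with coordinates. -/
lemma isInvertible_iff : IsInvertible L ↔ ∀ x : S, ∃ (U : S.Opens) (a : Γ(L, U)), x ∈ U ∧ IsGen a := by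
  refine forall_congr' fun x => ⟨?_, ?_⟩
  · rintro ⟨U, hx, ⟨e⟩⟩
    refine ⟨U.ι ''ᵁ ⊤, e.inv.app ⊤ (unitSection _ ⊤), by simpa using hx, ?_⟩
    exact (isGen_restrict_iff U.ι L (U := ⊤) _).1 (isGen_unitSection.app e.symm)
  · rintro ⟨U, a, hx, ha⟩
    refine ⟨U, hx, ?_⟩
    have h := ha.res (W := U.ι ''ᵁ ⊤) (by simp)
    obtain ⟨e, -⟩ := ((isGen_restrict_iff U.ι L (U := ⊤) _).2 h).exists_iso
    exact ⟨e.symm⟩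

/-! ### Pullback of generators -/

section Pullback

variable (f : T ⟶ S)

lemma resM_pullbackSectionOn (a : Γ(L, U)) (h : W ≤ U) :
    resM (pullbackSectionOn f U a) (f.preimage_mono h) = pullbackSectionOn f W (resM a h) :=
  (pullbackSectionOn_res f (homOfLE h) a).symm

lemma resM_pullbackSection_smul (a b : Γ(L, ⊤)) (r : Γ(S, U))
    (h : resM b le_top = r • resM a (le_top : U ≤ ⊤)) :
    resM (pullbackSection f b) (le_top : f ⁻¹ᵁ U ≤ ⊤) =
      f.app U r • resM (pullbackSection f a) le_top := by
  refine (resM_pullbackSectionOn f b le_top).trans ?_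
  rw [h, pullbackSectionOn_smul]
  exact congrArg _ (resM_pullbackSectionOn f a le_top).symm

/-- A global generator identifies `L` with the structure sheaf and itself with `1`, and the pullback
of `1` is `1`. -/
lemma IsGen.pullbackSection_top {a : Γ(L, ⊤)} (ha : IsGen a) : IsGen (pullbackSection f a) := by
  obtain ⟨e, rfl⟩ := ha.exists_iso
  rw [pullbackSection_natural]
  refine IsGen.app ?_ ((Scheme.Modules.pullback f).mapIso e)
  rw [← isGen_app_iff (asIso (pullbackUnitHom f))]
  have h := pullbackUnitHom_app f (1 : Γ(S, ⊤))
  rw [map_one] at h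
  exact (congrArg IsGen h).mpr isGen_unitSection

/-- For an open immersion, restriction and pullback are both left adjoint to pushforward. The
resulting isomorphism takes the restricted section to the pulled back one. -/
lemma isGen_pullbackSection_iff_of_isOpenImmersion [IsOpenImmersion f] (a : Γ(L, ⊤)) :
    IsGen (pullbackSection f a) ↔ IsGen (resM a (le_top : f ''ᵁ ⊤ ≤ ⊤)) := by
  have h := Adjunction.unit_leftAdjointUniq_hom_app (Scheme.Modules.restrictAdjunction f)
    (Scheme.Modules.pullbackPushforwardAdjunction f) L
  have h2 := ConcreteCategory.congr_hom (congrArg (fun ψ => Scheme.Modules.Hom.app ψ ⊤) h) a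
  have h3 : ((Scheme.Modules.restrictFunctorIsoPullback f).app L).hom.app ⊤
      (resM (L := L) a (le_top : f ''ᵁ ⊤ ≤ ⊤)) = pullbackSection f a := h2
  rw [← h3]
  exact (isGen_app_iff ((Scheme.Modules.restrictFunctorIsoPullback f).app L)).trans
    (isGen_restrict_iff f L _)

lemma isGen_pullbackSection_comp_iff {R : Scheme.{u}} (g : S ⟶ R) {M : R.Modules} (a : Γ(M, ⊤)) :
    IsGen (pullbackSection f (pullbackSection g a)) ↔ IsGen (pullbackSection (f ≫ g) a) := by
  rw [pullbackSection_comp]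
  exact isGen_app_iff ((Scheme.Modules.pullbackComp f g).symm.app M)

/-- Both restrictions are pullbacks along open immersions, so the global case applies to `f ∣_ U`;
the two ways around the square `f⁻¹U → S` agree. -/
lemma IsGen.resM_pullbackSection {a : Γ(L, ⊤)} (ha : IsGen (resM a (le_top : U ≤ ⊤))) :
    IsGen (resM (pullbackSection f a) (le_top : f ⁻¹ᵁ U ≤ ⊤)) := by
  have key {X Y : Scheme.{u}} {P : Y.Modules} (b : Γ(P, ⊤)) (j : X ⟶ Y) [IsOpenImmersion j] (W : Y.Opens)
      (hW : j ''ᵁ ⊤ = W) : IsGen (pullbackSection j b) ↔ IsGen (resM b (le_top : W ≤ ⊤)) := by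
    subst hW
    exact isGen_pullbackSection_iff_of_isOpenImmersion j b
  rw [← key _ U.ι _ (by simp)] at ha
  rw [← key _ (f ⁻¹ᵁ U).ι _ (by simp), isGen_pullbackSection_comp_iff]
  have h1 := ha.pullbackSection_top (f ∣_ U)
  rw [isGen_pullbackSection_comp_iff] at h1
  rwa [morphismRestrict_ι] at h1

end Pullback

/-! ### Fibers -/

lemma IsGen.ne_zero {a : Γ(L, U)} (ha : IsGen a) [Nonempty U] : a ≠ 0 := by
  rintro rfl
  exact one_ne_zero (ha.smul_injective (r := (1 : Γ(S, U))) (s := 0) (by simp))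

lemma pullbackSection_fiber_ne_zero {a : Γ(L, ⊤)} (ha : IsGen (resM a (le_top : U ≤ ⊤))) {s : S}
    (hs : s ∈ U) : pullbackSection (S.fromSpecResidueField s) a ≠ 0 := by
  intro h0
  have h1 := ha.resM_pullbackSection (S.fromSpecResidueField s)
  have : Nonempty (S.fromSpecResidueField s ⁻¹ᵁ U) :=
    ⟨⟨IsLocalRing.closedPoint _, by
      have := S.fromSpecResidueField_apply s (IsLocalRing.closedPoint (S.residueField s))
      exact (congrArg (· ∈ U) this).mpr hs⟩⟩
  exact h1.ne_zero (by rw [h0, resM_zero])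

/-- Write `a = g t` with a generator `t` near `s`. If `g` is invertible at `s`, then `a` generates
where `g` is invertible; otherwise `g` dies in the residue field, and `a` would vanish in the fiber.
-/
lemma exists_isGen_of_fiber_ne_zero (hL : IsInvertible L) {a : Γ(L, ⊤)} {s : S}
    (h : pullbackSection (S.fromSpecResidueField s) a ≠ 0) :
    ∃ U : S.Opens, s ∈ U ∧ IsGen (resM a (le_top : U ≤ ⊤)) := by
  obtain ⟨U, t, hs, ht⟩ := isInvertible_iff.1 hL s
  obtain ⟨g, hg⟩ := ht.exists_smul (resM a le_top)
  by_cases hsg : s ∈ S.basicOpen g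
  · refine ⟨S.basicOpen g, hsg, ?_⟩
    have h1 := congrArg (fun b => resM b (S.basicOpen_le g)) hg
    simp only [resM_resM, resM_smul] at h1
    rw [h1]
    exact (ht.res _).smul (S.toRingedSpace.isUnit_res_basicOpen g)
  · exfalso
    apply h
    set i := S.fromSpecResidueField s
    have h1 : i.app U g = 0 := by
      -- The spectrum of a field is reduced, so a function that is invertible nowhere is zero.
      rw [← AlgebraicGeometry.basicOpen_eq_bot_iff, ← Scheme.preimage_basicOpen, eq_bot_iff]
      intro x hx
      apply hsg
      have : i x = s := by
        simp [i]
      rw [← this]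
      exact hx
    have h2 : resM (pullbackSection i a) (le_top : i ⁻¹ᵁ U ≤ ⊤) = 0 := by
      refine (resM_pullbackSectionOn i a le_top).trans ?_
      rw [hg, pullbackSectionOn_smul, h1, zero_smul]
    have h3 : i ⁻¹ᵁ U = ⊤ := top_le_iff.1 fun x _ => by
      change i x ∈ U
      have : i x = s := by
        simp [i]
      rwa [this]
    have key {X : Scheme.{u}} {P : X.Modules} (b : Γ(P, ⊤)) (W : X.Opens) (hW : W = ⊤)
        (hb : resM b (le_top : W ≤ ⊤) = 0) : b = 0 := by
      subst hW
      rwa [resM_self] at hb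
    exact key _ _ h3 h2

lemma fiberwiseNonzero_iff (hL : IsInvertible L) {X : Type u} (φ : X → Γ(L, ⊤)) :
    FiberwiseNonzero φ ↔ ∀ s : S, ∃ (x : X) (U : S.Opens), s ∈ U ∧
      IsGen (resM (φ x) (le_top : U ≤ ⊤)) :=
  forall_congr' fun _ => exists_congr fun _ =>
    ⟨exists_isGen_of_fiber_ne_zero hL, fun ⟨_, hs, hg⟩ => pullbackSection_fiber_ne_zero hg hs⟩

end Generators

/-! ### Products of sections in coordinates -/

section Products

variable {S : Scheme.{u}} {L : S.Modules} {U : S.Opens}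

/-- The coordinate with respect to a generator. -/
def IsGen.coord {t : Γ(L, U)} (ht : IsGen t) : Γ(L, U) →ₗ[Γ(S, U)] Γ(S, U) :=
  (LinearEquiv.ofBijective (LinearMap.toSpanSingleton Γ(S, U) Γ(L, U) t) ht.bijective).symm

lemma IsGen.coord_smul {t : Γ(L, U)} (ht : IsGen t) (r : Γ(S, U)) : ht.coord (r • t) = r :=
  (LinearEquiv.ofBijective (LinearMap.toSpanSingleton Γ(S, U) Γ(L, U) t) ht.bijective).symm_apply_apply r

-- Apply the coordinate to both factors and multiply.
open TensorProduct in
lemma IsGen.mul_eq_of_tmul_eq {t : Γ(L, U)} (ht : IsGen t) {α β γ δ : Γ(S, U)}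
    (h : (α • t) ⊗ₜ[Γ(S, U)] (β • t) = (γ • t) ⊗ₜ[Γ(S, U)] (δ • t)) : α * β = γ * δ := by
  have h1 := congrArg (LinearMap.mul' Γ(S, U) Γ(S, U) ∘ₗ TensorProduct.map ht.coord ht.coord) h
  simpa only [LinearMap.comp_apply, TensorProduct.map_tmul, ht.coord_smul, LinearMap.mul'_apply] using h1

-- Equal sections of the sheafified tensor product need only agree locally as tensors. There the
-- coordinates can be compared, and functions that agree locally are equal.
open TensorProduct in
lemma IsGen.mul_eq_of_secMul_eq {a b c d : Γ(L, ⊤)} (h : secMul a b = secMul c d) {t : Γ(L, U)}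
    (ht : IsGen t) {α β γ δ : Γ(S, U)} (ha : resM a le_top = α • t) (hb : resM b le_top = β • t)
    (hc : resM c le_top = γ • t) (hd : resM d le_top = δ • t) : α * β = γ * δ := by
  have h1 : Presheaf.equalizerSieve (F := (tensorPre L L).presheaf) (X := .op ⊤)
      (a ⊗ₜ[Γ(S, ⊤)] b) (c ⊗ₜ[Γ(S, ⊤)] d) ∈ Opens.grothendieckTopology S ⊤ :=
    Presheaf.equalizerSieve_mem (Opens.grothendieckTopology S)
      (CategoryTheory.toSheafify (Opens.grothendieckTopology S) (tensorPre L L).presheaf) _ _ h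
  refine resO_ext fun x hx => ?_
  obtain ⟨V, i, hV, hxV⟩ := h1 x trivial
  refine ⟨U ⊓ V, inf_le_left, ⟨hx, hxV⟩, ?_⟩
  rw [resO_mul, resO_mul]
  apply (ht.res inf_le_left).mul_eq_of_tmul_eq
  simp only [← resM_smul, ← ha, ← hb, ← hc, ← hd, resM_resM]
  have h2 := congrArg ((tensorPre L L).presheaf.map (homOfLE (inf_le_right : U ⊓ V ≤ V)).op) hV
  have h3 (p q : Γ(L, ⊤)) : (tensorPre L L).presheaf.map (homOfLE (inf_le_right : U ⊓ V ≤ V)).op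
      ((tensorPre L L).presheaf.map i.op (p ⊗ₜ[Γ(S, ⊤)] q)) =
        resM p (le_top : U ⊓ V ≤ ⊤) ⊗ₜ[Γ(S, U ⊓ V)] resM q (le_top : U ⊓ V ≤ ⊤) := by
    refine Eq.trans (b := resM (resM p (le_top : V ≤ ⊤)) inf_le_right ⊗ₜ[Γ(S, U ⊓ V)]
      resM (resM q (le_top : V ≤ ⊤)) inf_le_right) rfl ?_
    rw [resM_resM, resM_resM]
  exact (h3 a b).symm.trans (h2.trans (h3 c d))

open TensorProduct in
lemma secMul_smul_smul (t : Γ(L, U)) (α β : Γ(S, U)) :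
    secMul (α • t) (β • t) = (toTensor L L).app (.op U) ((α * β) • (t ⊗ₜ[Γ(S, U)] t)) :=
  congrArg ((toTensor L L).app (.op U)) (TensorProduct.smul_tmul_smul α β t t)

lemma secMul_eq_of_locally {a b c d : Γ(L, ⊤)}
    (h : ∀ s : S, ∃ (U : S.Opens) (t : Γ(L, U)) (α β γ δ : Γ(S, U)), s ∈ U ∧
      resM a le_top = α • t ∧ resM b le_top = β • t ∧ resM c le_top = γ • t ∧
      resM d le_top = δ • t ∧ α * β = γ * δ) : secMul a b = secMul c d := by
  refine resM_ext fun s _ => ?_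
  obtain ⟨U, t, α, β, γ, δ, hs, ha, hb, hc, hd, hm⟩ := h s
  refine ⟨U, le_top, hs, (secMul_res _ _ _).trans (Eq.trans ?_ (secMul_res _ _ _).symm)⟩
  change secMul (resM a le_top) (resM b le_top) = secMul (resM c le_top) (resM d le_top)
  rw [ha, hb, hc, hd, secMul_smul_smul, secMul_smul_smul, hm]

end Products

/-! ### Isomorphisms from equal coordinates -/

section Gluing

variable {S : Scheme.{u}} {L M : S.Modules} {ι : Type*} {ρ : ι → Γ(L, ⊤)} {σ : ι → Γ(M, ⊤)}

/-- The sections `ρ v` and `σ v` are generators over `W`, and all `ρ w` and `σ w` have the same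
coordinates with respect to them. -/
structure SameCoords (ρ : ι → Γ(L, ⊤)) (σ : ι → Γ(M, ⊤)) (W : S.Opens) (v : ι) : Prop where
  left : IsGen (resM (ρ v) (le_top : W ≤ ⊤))
  right : IsGen (resM (σ v) (le_top : W ≤ ⊤))
  coords : ∀ w, ∃ g : Γ(S, W), resM (ρ w) le_top = g • resM (ρ v) (le_top : W ≤ ⊤) ∧
    resM (σ w) le_top = g • resM (σ v) (le_top : W ≤ ⊤)

lemma SameCoords.symm {W : S.Opens} {v : ι} (h : SameCoords ρ σ W v) : SameCoords σ ρ W v :=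
  ⟨h.right, h.left, fun w => (h.coords w).imp fun _ h => h.symm⟩

lemma SameCoords.res {W W' : S.Opens} {v : ι} (h : SameCoords ρ σ W v) (hW : W' ≤ W) :
    SameCoords ρ σ W' v where
  left := by simpa only [resM_resM] using h.left.res hW
  right := by simpa only [resM_resM] using h.right.res hW
  coords w := by
    obtain ⟨g, h1, h2⟩ := h.coords w
    refine ⟨resO g hW, ?_, ?_⟩
    · simpa only [resM_smul, resM_resM] using congrArg (fun b => resM b hW) h1
    · simpa only [resM_smul, resM_resM] using congrArg (fun b => resM b hW) h2

/-- Linear relations between two of the `ρ` carry over to the `σ`. This is the agreement on overlaps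
needed for gluing. -/
lemma SameCoords.smul_eq {W : S.Opens} {v v' : ι} (h : SameCoords ρ σ W v)
    {r r' : Γ(S, W)} (hr : r • resM (ρ v) (le_top : W ≤ ⊤) = r' • resM (ρ v') (le_top : W ≤ ⊤)) :
    r • resM (σ v) (le_top : W ≤ ⊤) = r' • resM (σ v') (le_top : W ≤ ⊤) := by
  obtain ⟨g, h1, h2⟩ := h.coords v'
  rw [h1, smul_smul] at hr
  rw [h2, smul_smul, h.left.smul_injective hr]

/-- The sections `x` of `L` and `y` of `M` have the same coordinates. -/
def Corr (ρ : ι → Γ(L, ⊤)) (σ : ι → Γ(M, ⊤)) {U : S.Opens} (x : Γ(L, U)) (y : Γ(M, U)) : Prop :=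
  ∀ (W : S.Opens) (hW : W ≤ U) (v : ι), SameCoords ρ σ W v → ∀ r : Γ(S, W),
    resM x hW = r • resM (ρ v) le_top → resM y hW = r • resM (σ v) le_top

lemma Corr.res {U W : S.Opens} {x : Γ(L, U)} {y : Γ(M, U)} (h : Corr ρ σ x y) (hW : W ≤ U) :
    Corr ρ σ (resM x hW) (resM y hW) := fun W' hW' v hv r hr => by
  rw [resM_resM] at hr ⊢
  exact h W' _ v hv r hr

lemma Corr.smul {U : S.Opens} {x : Γ(L, U)} {y : Γ(M, U)} (h : Corr ρ σ x y) (c : Γ(S, U)) :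
    Corr ρ σ (c • x) (c • y) := fun W hW v hv r hr => by
  obtain ⟨r', hr'⟩ := hv.left.exists_smul (resM x hW)
  rw [resM_smul, hr', smul_smul] at hr
  rw [resM_smul, h W hW v hv r' hr', smul_smul, hv.left.smul_injective hr]

lemma Corr.add {U : S.Opens} {x x' : Γ(L, U)} {y y' : Γ(M, U)} (h : Corr ρ σ x y)
    (h' : Corr ρ σ x' y') : Corr ρ σ (x + x') (y + y') := fun W hW v hv r hr => by
  obtain ⟨s, hs⟩ := hv.left.exists_smul (resM x hW)
  obtain ⟨s', hs'⟩ := hv.left.exists_smul (resM x' hW)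
  rw [resM_add, hs, hs', ← add_smul] at hr
  rw [resM_add, h W hW v hv s hs, h' W hW v hv s' hs', ← add_smul, hv.left.smul_injective hr]

lemma Corr.symm {U : S.Opens} {x : Γ(L, U)} {y : Γ(M, U)} (h : Corr ρ σ x y) : Corr σ ρ y x :=
  fun W hW v hv r hr => by
    obtain ⟨s, hs⟩ := hv.right.exists_smul (resM x hW)
    have h1 := h W hW v hv.symm s hs
    rw [hr] at h1
    rw [hs, hv.left.smul_injective h1]

lemma corr_section (w : ι) : Corr ρ σ (ρ w) (σ w) := fun W hW v hv r hr => by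
  obtain ⟨g, h1, h2⟩ := hv.coords w
  rw [h1] at hr
  rw [h2, hv.left.smul_injective hr]

variable (hcov : ∀ s : S, ∃ (W : S.Opens) (v : ι), s ∈ W ∧ SameCoords ρ σ W v)

include hcov in
lemma Corr.unique {U : S.Opens} {x : Γ(L, U)} {y y' : Γ(M, U)} (h : Corr ρ σ x y)
    (h' : Corr ρ σ x y') : y = y' := by
  refine resM_ext fun s hs => ?_
  obtain ⟨W, v, hsW, hv⟩ := hcov s
  have hv' := hv.res (inf_le_right : U ⊓ W ≤ W)
  obtain ⟨r, hr⟩ := hv'.left.exists_smul (resM x inf_le_left)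
  exact ⟨U ⊓ W, inf_le_left, ⟨hs, hsW⟩, (h _ inf_le_left v hv' r hr).trans
    (h' _ inf_le_left v hv' r hr).symm⟩

-- Locally `x = r • ρ v`, and `y` has to be `r • σ v` there. By `SameCoords.smul_eq` these sections
-- agree on overlaps, and the glued section is right with respect to every other chart as well.
include hcov in
lemma exists_corr {U : S.Opens} (x : Γ(L, U)) : ∃ y : Γ(M, U), Corr ρ σ x y := by
  choose W v hsW hv using hcov
  have hv' (s : U) := (hv s.1).res (inf_le_right : U ⊓ W s.1 ≤ W s.1)
  choose r hr using fun s : U => (hv' s).left.exists_smul (resM x inf_le_left)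
  obtain ⟨y, hy⟩ := resM_glue (L := M) (fun s : U => U ⊓ W s.1) (fun s => inf_le_left)
    (fun s => ⟨s.2, hsW s.1⟩) (fun s => r s • resM (σ (v s.1)) le_top) (fun s t => by
      have h1 := congrArg (fun b => resM b
        (inf_le_left : (U ⊓ W s.1) ⊓ (U ⊓ W t.1) ≤ U ⊓ W s.1)) (hr s)
      have h2 := congrArg (fun b => resM b
        (inf_le_right : (U ⊓ W s.1) ⊓ (U ⊓ W t.1) ≤ U ⊓ W t.1)) (hr t)
      simp only [resM_smul, resM_resM] at h1 h2 ⊢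
      exact ((hv' s).res inf_le_left).smul_eq (h1.symm.trans h2))
  refine ⟨y, fun W' hW' v' hv'' r' hr' => resM_ext fun s hs => ?_⟩
  let s' : U := ⟨s, hW' hs⟩
  refine ⟨W' ⊓ (U ⊓ W s), inf_le_left, ⟨hs, hW' hs, hsW s⟩, ?_⟩
  have h1 := congrArg (fun b => resM b (inf_le_right : W' ⊓ (U ⊓ W s) ≤ U ⊓ W s)) (hy s')
  have h2 := congrArg (fun b => resM b (inf_le_right : W' ⊓ (U ⊓ W s) ≤ U ⊓ W s)) (hr s')
  have h3 := congrArg (fun b => resM b (inf_le_left : W' ⊓ (U ⊓ W s) ≤ W')) hr'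
  simp only [resM_smul, resM_resM] at h1 h2 h3 ⊢
  rw [h1]
  exact ((hv' s').res inf_le_right).smul_eq (h2.symm.trans h3)

-- Since the corresponding section is unique, the assignment is automatically linear and compatible
-- with restriction.
include hcov in
lemma exists_hom_of_sameCoords : ∃ φ : L ⟶ M, ∀ (U : S.Opens) (x : Γ(L, U)),
    Corr ρ σ x (φ.app U x) := by
  choose f hf using fun (U : S.Opens) (x : Γ(L, U)) => exists_corr hcov x
  let g (U : S.Opens) : Γ(L, U) →ₗ[Γ(S, U)] Γ(M, U) :=
    { toFun := f U
      map_add' := fun x y => (hf _ _).unique hcov ((hf _ x).add (hf _ y))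
      map_smul' := fun r x => (hf _ _).unique hcov ((hf _ x).smul r) }
  exact ⟨⟨{
    app := fun U => ModuleCat.ofHom (X := L.val.obj U) (Y := M.val.obj U) (g U.unop)
    naturality := fun {U W} i => by
      refine ModuleCat.hom_ext (LinearMap.ext fun (x : Γ(L, U.unop)) => ?_)
      exact (hf W.unop (resM x i.unop.le)).unique hcov ((hf U.unop x).res i.unop.le) }⟩, hf⟩

include hcov in
/-- Two families of sections with the same coordinates are isomorphic. -/
lemma exists_iso_of_sameCoords : ∃ e : L ≅ M, ∀ v, e.hom.app ⊤ (ρ v) = σ v := by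
  obtain ⟨φ, hφ⟩ := exists_hom_of_sameCoords hcov
  have hcov' : ∀ s : S, ∃ (W : S.Opens) (v : ι), s ∈ W ∧ SameCoords σ ρ W v := fun s => by
    obtain ⟨W, v, h1, h2⟩ := hcov s
    exact ⟨W, v, h1, h2.symm⟩
  have : IsIso φ := by
    rw [Scheme.Modules.Hom.isIso_iff_isIso_app]
    intro U
    refine (ConcreteCategory.isIso_iff_bijective _).2 ⟨fun x x' h => ?_, fun y => ?_⟩
    · have h1 := (hφ U x).symm
      rw [h] at h1
      exact h1.unique hcov' (hφ U x').symm
    · obtain ⟨x, hx⟩ := exists_corr hcov' y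
      exact ⟨x, (hφ U x).unique hcov hx.symm⟩
  exact ⟨asIso φ, fun v => (hφ ⊤ (ρ v)).unique hcov (corr_section v)⟩

end Gluing

/-! ### The twisting sheaf is generated by elements of the ring -/

section Proj

variable {A : Type u} {σ : Type*} [CommRing A] [SetLike σ A] [AddSubgroupClass σ A]
  (𝒜 : ℕ → σ) [GradedRing 𝒜]

/-- The value of a function on an open subset of `Proj 𝒜` at a point. -/
def valueO {W : (Proj 𝒜).Opens} (g : Γ(Proj 𝒜, W)) (x : W) : LocAt 𝒜 x.1 :=
  (g.1 x).val

/-- The value of a section of `𝒪(d)` at a point. -/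
def valueM {d : ℕ} {W : (Proj 𝒜).Opens} (s : Γ(twist 𝒜 d, W)) (x : W) : LocAt 𝒜 x.1 :=
  s.1 x

lemma valueO_ext {W : (Proj 𝒜).Opens} {g h : Γ(Proj 𝒜, W)}
    (H : ∀ x, valueO 𝒜 g x = valueO 𝒜 h x) : g = h :=
  Subtype.ext (funext fun x => HomogeneousLocalization.val_injective _ (H x))

lemma valueM_ext {d : ℕ} {W : (Proj 𝒜).Opens} {s t : Γ(twist 𝒜 d, W)}
    (H : ∀ x, valueM 𝒜 s x = valueM 𝒜 t x) : s = t :=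
  Subtype.ext (funext H)

lemma valueM_smul {d : ℕ} {W : (Proj 𝒜).Opens} (g : Γ(Proj 𝒜, W)) (s : Γ(twist 𝒜 d, W)) (x : W) :
    valueM 𝒜 (g • s) x = valueO 𝒜 g x * valueM 𝒜 s x := rfl

lemma valueM_resM_twistSection {d : ℕ} (r : 𝒜 d) {W : (Proj 𝒜).Opens} (x : W) :
    valueM 𝒜 (resM (twistSection 𝒜 d r) (le_top : W ≤ ⊤)) x = algebraMap A _ r.1 := rfl

lemma isUnit_algebraMap_locAt {x : ProjectiveSpectrum.top 𝒜} {f : A} (hx : f ∉ x.asHomogeneousIdeal) :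
    IsUnit (algebraMap A (LocAt 𝒜 x) f) :=
  IsLocalization.map_units (M := (ProjectiveSpectrum.asHomogeneousIdeal (𝒜 := 𝒜) x).toIdeal.primeCompl)
    (LocAt 𝒜 x) ⟨f, hx⟩

lemma mul_notMem_asHomogeneousIdeal {x : ProjectiveSpectrum.top 𝒜} {f g : A}
    (hf : f ∉ x.asHomogeneousIdeal) (hg : g ∉ x.asHomogeneousIdeal) :
    f * g ∉ x.asHomogeneousIdeal :=
  (ProjectiveSpectrum.asHomogeneousIdeal (𝒜 := 𝒜) x).toIdeal.primeCompl.mul_mem hf hg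

/-- The fraction `r / t` in the homogeneous localization at a point. -/
def fracAt (x : ProjectiveSpectrum.top 𝒜) {i : ℕ} (r t : 𝒜 i) (ht : t.1 ∉ x.asHomogeneousIdeal) :
    HomogeneousLocalization.AtPrime 𝒜 (ProjectiveSpectrum.asHomogeneousIdeal (𝒜 := 𝒜) x).toIdeal :=
  HomogeneousLocalization.mk ⟨i, r, t, ht⟩

lemma val_fracAt (x : ProjectiveSpectrum.top 𝒜) {i : ℕ} (r t : 𝒜 i)
    (ht : t.1 ∉ x.asHomogeneousIdeal) :
    (fracAt 𝒜 x r t ht).val = (Localization.mk r.1 ⟨t.1, ht⟩ : LocAt 𝒜 x) := rfl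

lemma mk_eq_iff_mul_algebraMap (x : ProjectiveSpectrum.top 𝒜) (r t : A)
    (ht : t ∉ x.asHomogeneousIdeal) (z : LocAt 𝒜 x) :
    z = Localization.mk r ⟨t, ht⟩ ↔ z * algebraMap A _ t = algebraMap A _ r := by
  rw [Localization.mk_eq_mk']
  exact IsLocalization.eq_mk'_iff_mul_eq

lemma fracAt_mul_algebraMap (x : ProjectiveSpectrum.top 𝒜) {i d : ℕ} (r : 𝒜 (i + d)) (t : 𝒜 i)
    (f : 𝒜 d) (ht : t.1 ∉ x.asHomogeneousIdeal) (hf : f.1 ∉ x.asHomogeneousIdeal) :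
    (fracAt 𝒜 x r ⟨t.1 * f.1, SetLike.mul_mem_graded t.2 f.2⟩
      (mul_notMem_asHomogeneousIdeal 𝒜 ht hf)).val * algebraMap A (LocAt 𝒜 x) f.1 =
        Localization.mk r.1 ⟨t.1, ht⟩ := by
  rw [mk_eq_iff_mul_algebraMap, mul_assoc, ← map_mul, mul_comm f.1, val_fracAt]
  exact (mk_eq_iff_mul_algebraMap 𝒜 x _ _ _ _).1 rfl

/-- Where `f` does not vanish, it is a unit in the stalks, and a fraction `r / t` of degree `d` is
`f` times the fraction `r / (t f)` of degree zero. -/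
lemma isGen_twistSection {d : ℕ} (f : 𝒜 d) :
    IsGen (resM (twistSection 𝒜 d f) (le_top : Proj.basicOpen 𝒜 f.1 ≤ ⊤)) := by
  intro W hW
  rw [resM_resM]
  refine ⟨fun g h hgh => valueO_ext 𝒜 fun x => ?_, fun s => ?_⟩
  · have h1 := congrArg (fun s => valueM 𝒜 s x) hgh
    simp only [valueM_smul, valueM_resM_twistSection] at h1
    exact (isUnit_algebraMap_locAt 𝒜 (hW x.2)).mul_left_injective h1
  · have hloc (x : W) : ∃ (V : (Proj 𝒜).Opens) (_ : x.1 ∈ V) (hV : V ≤ W) (i : ℕ) (r t : 𝒜 i)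
        (ht : ∀ y : V, t.1 ∉ (ProjectiveSpectrum.asHomogeneousIdeal (𝒜 := 𝒜) y.1)), ∀ y : V,
        valueM 𝒜 s ⟨y.1, hV y.2⟩ =
          (fracAt 𝒜 y.1 r t (ht y)).val * algebraMap A (LocAt 𝒜 y.1) f.1 := by
      obtain ⟨V, hxV, j, i, r, t, ht, H⟩ := s.2 x
      have hfy (y : V) := hW (j.le y.2)
      refine ⟨V, hxV, j.le, i + d, r, ⟨t.1 * f.1, SetLike.mul_mem_graded t.2 f.2⟩, fun y =>
        mul_notMem_asHomogeneousIdeal 𝒜 (ht y) (hfy y), fun y => ?_⟩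
      exact (H y).trans (fracAt_mul_algebraMap 𝒜 y.1 r t f (ht y) (hfy y)).symm
    choose V hxV hVW i r t ht H using hloc
    -- The value at each point comes from that point's own choice of fraction. Since division by `f`
    -- is unique, the fraction chosen at `x` gives the values on all of `V x`.
    let g (x : W) := fracAt 𝒜 x.1 (r x) (t x) (ht x ⟨x.1, hxV x⟩)
    have hg (x : W) (y : V x) : g ⟨y.1, hVW x y.2⟩ = fracAt 𝒜 y.1 (r x) (t x) (ht x y) := by
      apply HomogeneousLocalization.val_injective
      apply (isUnit_algebraMap_locAt 𝒜 (hW (hVW x y.2))).mul_left_injective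
      exact (H ⟨y.1, hVW x y.2⟩ ⟨y.1, hxV _⟩).symm.trans (H x y)
    refine ⟨⟨g, fun x => ⟨V x, hxV x, homOfLE (hVW x), i x, r x, t x, ht x, hg x⟩⟩,
      valueM_ext 𝒜 fun x => ?_⟩
    exact (H x ⟨x.1, hxV x⟩).symm

/-- The function `b / a` on the open subset of `Proj 𝒜` where `a` does not vanish. -/
def fracSection {d : ℕ} (a b : 𝒜 d) : Γ(Proj 𝒜, Proj.basicOpen 𝒜 a.1) :=
  Proj.awayToSection 𝒜 a.1 (HomogeneousLocalization.mk ⟨d, b, a, Submonoid.mem_powers _⟩)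

lemma valueO_fracSection {d : ℕ} (a b : 𝒜 d) (x : Proj.basicOpen 𝒜 a.1) :
    valueO 𝒜 (fracSection 𝒜 a b) x = Localization.mk b.1 ⟨a.1, x.2⟩ := by
  refine (ProjectiveSpectrum.Proj.awayToSection_apply 𝒜 a.1 _ x).trans ?_
  rw [HomogeneousLocalization.val_mk, Localization.mk_eq_mk', IsLocalization.map_mk',
    Localization.mk_eq_mk']
  rfl

lemma resM_twistSection_eq {d : ℕ} (a b : 𝒜 d) :
    resM (twistSection 𝒜 d b) (le_top : Proj.basicOpen 𝒜 a.1 ≤ ⊤) =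
      fracSection 𝒜 a b • resM (twistSection 𝒜 d a) le_top := by
  refine valueM_ext 𝒜 fun x => ?_
  rw [valueM_smul, valueM_resM_twistSection, valueM_resM_twistSection, valueO_fracSection]
  exact ((mk_eq_iff_mul_algebraMap 𝒜 x.1 b.1 a.1 x.2 _).1 rfl).symm

end Proj

/-! ### Morphisms to `Proj` -/

section ProjMorphisms

variable {A : Type u} {σ : Type*} [CommRing A] [SetLike σ A] [AddSubgroupClass σ A]
  (𝒜 : ℕ → σ) [GradedRing 𝒜]

lemma valueO_mul {W : (Proj 𝒜).Opens} (g h : Γ(Proj 𝒜, W)) (x : W) :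
    valueO 𝒜 (g * h) x = valueO 𝒜 g x * valueO 𝒜 h x := HomogeneousLocalization.val_mul _ _

lemma valueO_add {W : (Proj 𝒜).Opens} (g h : Γ(Proj 𝒜, W)) (x : W) :
    valueO 𝒜 (g + h) x = valueO 𝒜 g x + valueO 𝒜 h x := HomogeneousLocalization.val_add _ _

lemma valueO_one {W : (Proj 𝒜).Opens} (x : W) : valueO 𝒜 (1 : Γ(Proj 𝒜, W)) x = 1 :=
  HomogeneousLocalization.val_one

lemma valueO_resO {W W' : (Proj 𝒜).Opens} (g : Γ(Proj 𝒜, W)) (h : W' ≤ W) (x : W') :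
    valueO 𝒜 (resO g h) x = valueO 𝒜 g ⟨x.1, h x.2⟩ := rfl

lemma valueO_fracSection_mul {d : ℕ} (a b : 𝒜 d) (x : Proj.basicOpen 𝒜 a.1) :
    valueO 𝒜 (fracSection 𝒜 a b) x * algebraMap A _ a.1 = algebraMap A _ b.1 :=
  (mk_eq_iff_mul_algebraMap 𝒜 x.1 b.1 a.1 x.2 _).1 (valueO_fracSection 𝒜 a b x)

lemma notMem_of_isUnit_algebraMap {x : ProjectiveSpectrum.top 𝒜} {f : A}
    (h : IsUnit (algebraMap A (LocAt 𝒜 x) f)) : f ∉ x.asHomogeneousIdeal :=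
  (IsLocalization.AtPrime.isUnit_to_map_iff (LocAt 𝒜 x)
    (ProjectiveSpectrum.asHomogeneousIdeal (𝒜 := 𝒜) x).toIdeal f).1 h

/-- At a point where `b / a` is invertible, `b = (b / a) a` is a product of units of the stalk. -/
lemma basicOpen_fracSection_le {d : ℕ} (a b : 𝒜 d) :
    (Proj 𝒜).basicOpen (fracSection 𝒜 a b) ≤ Proj.basicOpen 𝒜 b.1 := by
  intro x hx
  have hle := (Proj 𝒜).basicOpen_le (fracSection 𝒜 a b)
  obtain ⟨z, hz⟩ := isUnit_iff_exists_inv.1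
    ((Proj 𝒜).toRingedSpace.isUnit_res_basicOpen (fracSection 𝒜 a b))
  have h1 : valueO 𝒜 (fracSection 𝒜 a b) ⟨x, hle hx⟩ *
      valueO 𝒜 (W := (Proj 𝒜).basicOpen (fracSection 𝒜 a b)) z ⟨x, hx⟩ = 1 :=
    ((valueO_mul 𝒜 (resO (fracSection 𝒜 a b) hle) z ⟨x, hx⟩).symm.trans
      (congrArg (fun y => valueO 𝒜 y ⟨x, hx⟩) hz)).trans (valueO_one 𝒜 ⟨x, hx⟩)
  refine notMem_of_isUnit_algebraMap 𝒜 (x := x) ?_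
  have h3 := (IsUnit.of_mul_eq_one _ h1).mul (isUnit_algebraMap_locAt 𝒜 (hle hx))
  exact (congrArg IsUnit (valueO_fracSection_mul 𝒜 a b ⟨x, hle hx⟩)).mp h3

lemma resO_fracSection_mul {d : ℕ} (a b c : 𝒜 d) {W : (Proj 𝒜).Opens}
    (ha : W ≤ Proj.basicOpen 𝒜 a.1) (hb : W ≤ Proj.basicOpen 𝒜 b.1) :
    resO (fracSection 𝒜 b c) hb * resO (fracSection 𝒜 a b) ha = resO (fracSection 𝒜 a c) ha := by
  refine valueO_ext 𝒜 fun x => ?_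
  apply (isUnit_algebraMap_locAt 𝒜 (ha x.2)).mul_left_injective
  change _ * algebraMap A _ a.1 = _ * algebraMap A _ a.1
  rw [valueO_mul, valueO_resO, valueO_resO, valueO_resO, valueO_fracSection_mul, mul_assoc]
  exact (congrArg (_ * ·) (valueO_fracSection_mul 𝒜 a b ⟨x.1, ha x.2⟩)).trans
    (valueO_fracSection_mul 𝒜 b c ⟨x.1, hb x.2⟩)

variable {T : Scheme.{u}}

/-- The homomorphism is recovered, up to the identification of `Γ(T, U)` with the global functions
on `U`, by taking global sections. -/
lemma Opens_toSpecΓ_map_injective {B : CommRingCat.{u}} (U : T.Opens) {φ ψ : B ⟶ Γ(T, U)}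
    (h : U.toSpecΓ ≫ Spec.map φ = U.toSpecΓ ≫ Spec.map ψ) : φ = ψ := by
  have key (φ : B ⟶ Γ(T, U)) : (Scheme.ΓSpecIso B).inv ≫ (U.toSpecΓ ≫ Spec.map φ).appTop =
      φ ≫ U.topIso.inv := by
    rw [Scheme.Hom.comp_appTop, Scheme.Opens.toSpecΓ_appTop, Scheme.ΓSpecIso_naturality_assoc,
      Iso.inv_hom_id_assoc]
  rw [← cancel_mono U.topIso.inv, ← key, h, key]

variable {f : A} {m : ℕ} (hf : f ∈ 𝒜 m) (hm : 0 < m)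

include hf hm in
/-- Morphisms to an affine chart of `Proj` are determined by ring homomorphisms. -/
lemma Opens_ι_comp_eq_of_appLE_eq {k k' : T ⟶ Proj 𝒜} {U : T.Opens}
    (e : U ≤ k ⁻¹ᵁ Proj.basicOpen 𝒜 f) (e' : U ≤ k' ⁻¹ᵁ Proj.basicOpen 𝒜 f)
    (h : Proj.awayToSection 𝒜 f ≫ k.appLE _ U e = Proj.awayToSection 𝒜 f ≫ k'.appLE _ U e') :
    U.ι ≫ k = U.ι ≫ k' := by
  have h1 : k.appLE _ U e = k'.appLE _ U e' := by
    rw [← Proj.basicOpenIsoAway_hom 𝒜 f hf hm] at h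
    exact (cancel_epi _).1 h
  have : IsAffine (Proj.basicOpen 𝒜 f).toScheme := Proj.isAffineOpen_basicOpen 𝒜 f hf hm
  have h2 : k.resLE _ U e = k'.resLE _ U e' := by
    refine ext_of_isAffine ?_
    refine (Scheme.Hom.resLE_app_top k e).trans ?_
    rw [h1]
    exact (Scheme.Hom.resLE_app_top k' e').symm
  rw [← Scheme.Hom.resLE_comp_ι k e, h2, Scheme.Hom.resLE_comp_ι]

-- The morphism is the composite of `T → Spec Γ(T, ⊤)`, `Spec φ` and the inclusion of the chart. The
-- last equation serves to check compatibility with the base.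
include hf hm in
lemma exists_hom_of_away (φ : CommRingCat.of (HomogeneousLocalization.Away 𝒜 f) ⟶ Γ(T, ⊤)) :
    ∃ (h : T ⟶ Proj 𝒜) (e : ⊤ ≤ h ⁻¹ᵁ Proj.basicOpen 𝒜 f),
      Proj.awayToSection 𝒜 f ≫ h.appLE _ ⊤ e = φ ∧
      h ≫ Proj.toSpecZero 𝒜 = T.toSpecΓ ≫ Spec.map
        (CommRingCat.ofHom (HomogeneousLocalization.fromZeroRingHom 𝒜 _) ≫ φ) := by
  let h : T ⟶ Proj 𝒜 := T.toSpecΓ ≫ Spec.map φ ≫ Proj.awayι 𝒜 f hf hm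
  have e : ⊤ ≤ h ⁻¹ᵁ Proj.basicOpen 𝒜 f := by
    rintro x -
    change h x ∈ Proj.basicOpen 𝒜 f
    rw [← Proj.opensRange_awayι 𝒜 f hf hm]
    exact ⟨(T.toSpecΓ ≫ Spec.map φ) x, rfl⟩
  refine ⟨h, e, ?_, ?_⟩
  · apply Opens_toSpecΓ_map_injective
    have h1 : h.resLE _ ⊤ e = (⊤ : T.Opens).toSpecΓ ≫ Spec.map φ ≫
        (Proj.basicOpenIsoSpec 𝒜 f hf hm).inv := by
      rw [← cancel_mono (Proj.basicOpen 𝒜 f).ι, Scheme.Hom.resLE_comp_ι, Scheme.Opens.toSpecΓ_top]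
      simp only [h, Category.assoc, Proj.awayι]
    have h2 : h.resLE _ ⊤ e ≫ Proj.basicOpenToSpec 𝒜 f = (⊤ : T.Opens).toSpecΓ ≫ Spec.map φ := by
      rw [h1, ← Proj.basicOpenIsoSpec_hom 𝒜 f hf hm]
      simp only [Category.assoc, Iso.inv_hom_id, Category.comp_id]
    rw [← h2, Spec.map_comp, Scheme.Opens.toSpecΓ_SpecMap_appLE_assoc]
    rfl
  · simp only [h, Category.assoc, Proj.awayι_toSpecZero, Spec.map_comp]

end ProjMorphisms

/-! ### Morphisms to `Proj` with prescribed homogeneous coordinates -/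

section Coordinates

lemma appLE_resO {X Y : Scheme.{u}} (k : X ⟶ Y) {U U' : Y.Opens} {W : X.Opens} (h : U' ≤ U)
    (e : W ≤ k ⁻¹ᵁ U') (r : Γ(Y, U)) :
    k.appLE U' W e (resO r h) = k.appLE U W (e.trans (k.preimage_mono h)) r :=
  ConcreteCategory.congr_hom (k.map_appLE e (homOfLE h).op) r

lemma resO_appLE {X Y : Scheme.{u}} (k : X ⟶ Y) {U : Y.Opens} {W W' : X.Opens}
    (e : W ≤ k ⁻¹ᵁ U) (h : W' ≤ W) (r : Γ(Y, U)) :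
    resO (k.appLE U W e r) h = k.appLE U W' (h.trans e) r :=
  ConcreteCategory.congr_hom (k.appLE_map e (homOfLE h).op) r

lemma appLE_appLE {X Y Z : Scheme.{u}} (f : X ⟶ Y) (g : Y ⟶ Z) {U : Z.Opens} {W : Y.Opens}
    {W' : X.Opens} (e₁ : W ≤ g ⁻¹ᵁ U) (e₂ : W' ≤ f ⁻¹ᵁ W) (r : Γ(Z, U)) :
    f.appLE W W' e₂ (g.appLE U W e₁ r) =
      (f ≫ g).appLE U W' (e₂.trans (f.preimage_mono e₁)) r :=
  ConcreteCategory.congr_hom (Scheme.Hom.appLE_comp_appLE f g U W W' e₁ e₂) r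

variable {A : Type u} {σ : Type*} [CommRing A] [SetLike σ A] [AddSubgroupClass σ A]
  (𝒜 : ℕ → σ) [GradedRing 𝒜] {ι : Type u} {d : ℕ} (a : ι → 𝒜 d)
  {S : Scheme.{u}} {L : S.Modules} (ρ : ι → Γ(L, ⊤))

/-- The morphism `h : T ⟶ Proj 𝒜` has the homogeneous coordinates `ρ`, pulled back along
`j : T ⟶ S`, with respect to the homogeneous elements `a`. -/
def HasCoords {T : Scheme.{u}} (j : T ⟶ S) (h : T ⟶ Proj 𝒜) : Prop :=
  ∀ (W : S.Opens) (v : ι), IsGen (resM (ρ v) (le_top : W ≤ ⊤)) →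
    j ⁻¹ᵁ W ≤ h ⁻¹ᵁ Proj.basicOpen 𝒜 (a v).1 ∧
    ∀ (w : ι) (g : Γ(S, W)), resM (ρ w) (le_top : W ≤ ⊤) = g • resM (ρ v) le_top →
      ∀ (U : T.Opens) (e : U ≤ j ⁻¹ᵁ W) (e' : U ≤ h ⁻¹ᵁ Proj.basicOpen 𝒜 (a v).1),
        h.appLE _ U e' (fracSection 𝒜 (a v) (a w)) = j.appLE W U e g

/-- Locally on `S` one of the sections `ρ v` is a generator. -/
def LocallyGen : Prop :=
  ∀ s : S, ∃ (v : ι) (W : S.Opens), s ∈ W ∧ IsGen (resM (ρ v) (le_top : W ≤ ⊤))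

variable {𝒜 a ρ}

lemma HasCoords.comp {T T' : Scheme.{u}} (k : T' ⟶ T) {j : T ⟶ S} {h : T ⟶ Proj 𝒜}
    (H : HasCoords 𝒜 a ρ j h) : HasCoords 𝒜 a ρ (k ≫ j) (k ≫ h) := fun W v hv => by
  obtain ⟨h1, h2⟩ := H W v hv
  refine ⟨k.preimage_mono h1, fun w g hg U e e' => ?_⟩
  exact ((appLE_appLE k h h1 e _).symm.trans
    (congrArg (k.appLE (j ⁻¹ᵁ W) U e) (h2 w g hg _ le_rfl h1))).trans (appLE_appLE k j le_rfl e _)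

lemma HasCoords.of_openCover {T : Scheme.{u}} {j : T ⟶ S} {h : T ⟶ Proj 𝒜} (𝒰 : T.OpenCover)
    (H : ∀ i, HasCoords 𝒜 a ρ (𝒰.f i ≫ j) (𝒰.f i ≫ h)) : HasCoords 𝒜 a ρ j h := fun W v hv => by
  refine ⟨fun t ht => ?_, fun w g hg U e e' => ?_⟩
  · obtain ⟨i, y, rfl⟩ := 𝒰.exists_eq t
    exact (H i W v hv).1 (x := y) ht
  · refine 𝒰.ext_elem _ _ fun i => ?_
    rw [Scheme.Hom.app_eq_appLE, appLE_appLE, appLE_appLE]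
    exact (H i W v hv).2 w g hg _ _ _

/-- If the fractions of the `a w` generate, a morphism is determined by its coordinates. -/
lemma HasCoords.unique (hd : 0 < d) (hρ : LocallyGen ρ)
    (hgen : ∀ (v : ι) (B : CommRingCat.{u})
      (φ ψ : CommRingCat.of (HomogeneousLocalization.Away 𝒜 (a v).1) ⟶ B),
      (∀ w, φ (HomogeneousLocalization.mk ⟨d, a w, a v, Submonoid.mem_powers _⟩) =
        ψ (HomogeneousLocalization.mk ⟨d, a w, a v, Submonoid.mem_powers _⟩)) → φ = ψ)
    {T : Scheme.{u}} {j : T ⟶ S} {h h' : T ⟶ Proj 𝒜} (H : HasCoords 𝒜 a ρ j h)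
    (H' : HasCoords 𝒜 a ρ j h') : h = h' := by
  refine Scheme.hom_ext_of_forall _ _ fun t => ?_
  obtain ⟨v, W, hW, hv⟩ := hρ (j t)
  obtain ⟨h1, h2⟩ := H W v hv
  obtain ⟨h1', h2'⟩ := H' W v hv
  -- Over `j ⁻¹ᵁ W` both morphisms land in the affine chart of `a v`, and both pull the fractions `a
  -- w / a v` back to the same functions.
  refine ⟨j ⁻¹ᵁ W, hW, Opens_ι_comp_eq_of_appLE_eq 𝒜 (a v).2 hd h1 h1' ?_⟩
  refine hgen v _ _ _ fun w => ?_
  obtain ⟨g, hg⟩ := hv.exists_smul (resM (ρ w) le_top)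
  exact (h2 w g hg _ le_rfl h1).trans (h2' w g hg _ le_rfl h1').symm

/-- The morphism is built from the single generator `ρ v`, but must have the right coordinates for
every generator `ρ v'`. Where both generate, the ratio `ρ v' / ρ v` is a unit, so the morphism lands
in the chart of `a v'`, and the ratios to `ρ v'` follow from those to `ρ v`. -/
lemma exists_hasCoords_of_away (hd : 0 < d) {T : Scheme.{u}} {j : T ⟶ S} {W : S.Opens} {v : ι}
    (hv : IsGen (resM (ρ v) (le_top : W ≤ ⊤))) (hj : ⊤ ≤ j ⁻¹ᵁ W) (g : ι → Γ(S, W))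
    (hg : ∀ w, resM (ρ w) (le_top : W ≤ ⊤) = g w • resM (ρ v) le_top)
    (φ : CommRingCat.of (HomogeneousLocalization.Away 𝒜 (a v).1) ⟶ Γ(T, ⊤))
    (hφ : ∀ w, φ (HomogeneousLocalization.mk ⟨d, a w, a v, Submonoid.mem_powers _⟩) =
      j.appLE W ⊤ hj (g w)) :
    ∃ h : T ⟶ Proj 𝒜, HasCoords 𝒜 a ρ j h ∧
      h ≫ Proj.toSpecZero 𝒜 = T.toSpecΓ ≫ Spec.map
        (CommRingCat.ofHom (HomogeneousLocalization.fromZeroRingHom 𝒜 _) ≫ φ) := by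
  obtain ⟨h, e, he, hz⟩ := exists_hom_of_away 𝒜 (a v).2 hd φ
  refine ⟨h, fun W' v' hv' => ?_, hz⟩
  have hval (w : ι) : h.appLE _ ⊤ e (fracSection 𝒜 (a v) (a w)) = j.appLE W ⊤ hj (g w) :=
    (ConcreteCategory.congr_hom he _).trans (hφ w)
  have hgv' : resM (resM (ρ v') le_top) (inf_le_left : W' ⊓ W ≤ W') =
      resO (g v') (inf_le_right : W' ⊓ W ≤ W) • resM (ρ v) (le_top : W' ⊓ W ≤ ⊤) := by
    rw [← resM_resM (ρ v) le_top (inf_le_right : W' ⊓ W ≤ W), ← resM_smul, ← hg, resM_resM, resM_resM]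
  have hunit : IsUnit (resO (g v') (inf_le_right : W' ⊓ W ≤ W)) := by
    refine IsGen.isUnit_of_smul (a := resM (ρ v) (le_top : W' ⊓ W ≤ ⊤)) ?_ ?_
    · simpa only [resM_resM] using hv.res (inf_le_right : W' ⊓ W ≤ W)
    · rw [← hgv']
      exact hv'.res _
  -- As `j` lands in `W`, what is known over `W' ⊓ W` holds on the whole preimage of `W'`.
  have hle : j ⁻¹ᵁ W' ≤ j ⁻¹ᵁ (W' ⊓ W) := fun t ht => ⟨ht, hj trivial⟩
  have hunit' : IsUnit (j.appLE W (j ⁻¹ᵁ W') (le_top.trans hj) (g v')) := by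
    have := hunit.map (j.appLE (W' ⊓ W) (j ⁻¹ᵁ W') hle).hom
    rwa [appLE_resO] at this
  have h1 : j ⁻¹ᵁ W' ≤ h ⁻¹ᵁ Proj.basicOpen 𝒜 (a v').1 := by
    have h2 := T.basicOpen_of_isUnit hunit'
    rw [← resO_appLE j hj le_top, ← hval, resO_appLE, Scheme.basicOpen_appLE] at h2
    exact h2.symm.le.trans (inf_le_right.trans
      (h.preimage_mono (basicOpen_fracSection_le 𝒜 (a v) (a v'))))
  refine ⟨h1, fun w c hc U eU eU' => ?_⟩
  have hcg : resO c (inf_le_left : W' ⊓ W ≤ W') * resO (g v') inf_le_right =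
      resO (g w) inf_le_right := by
    refine IsGen.smul_injective (a := resM (ρ v) (le_top : W' ⊓ W ≤ ⊤)) ?_ ?_
    · simpa only [resM_resM] using hv.res (inf_le_right : W' ⊓ W ≤ W)
    · rw [mul_smul, ← hgv', ← resM_smul, ← hc, resM_resM,
        ← resM_resM (ρ v) le_top (inf_le_right : W' ⊓ W ≤ W), ← resM_smul, ← hg, resM_resM]
  have hcg' := congrArg (j.appLE _ U (eU.trans hle)) hcg
  rw [map_mul, appLE_resO, appLE_resO, appLE_resO] at hcg'
  have eU₂ : U ≤ h ⁻¹ᵁ (Proj.basicOpen 𝒜 (a v).1 ⊓ Proj.basicOpen 𝒜 (a v').1) :=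
    le_inf (le_top.trans e) eU'
  -- On `Proj` the fractions satisfy the same identity as the ratios in `hcg`. Comparing the two and
  -- cancelling the unit `g v'` gives the claim.
  have hfr := congrArg (h.appLE _ U eU₂)
    (resO_fracSection_mul 𝒜 (a v) (a v') (a w) inf_le_left inf_le_right)
  rw [map_mul, appLE_resO, appLE_resO, appLE_resO] at hfr
  have hval' (w : ι) : h.appLE _ U (le_top.trans e) (fracSection 𝒜 (a v) (a w)) =
      j.appLE W U (le_top.trans hj) (g w) := by
    rw [← resO_appLE h e le_top, hval, resO_appLE]
  rw [hval', hval', ← hcg'] at hfr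
  refine IsUnit.mul_right_cancel ?_ hfr
  have := hunit'.map (T.presheaf.map (homOfLE eU).op).hom
  exact (congrArg IsUnit (resO_appLE j _ eU (g v'))).mp this

/-- Morphisms with prescribed coordinates can be glued. -/
lemma exists_hasCoords (hd : 0 < d) (hρ : LocallyGen ρ)
    (hgen : ∀ (v : ι) (B : CommRingCat.{u})
      (φ ψ : CommRingCat.of (HomogeneousLocalization.Away 𝒜 (a v).1) ⟶ B),
      (∀ w, φ (HomogeneousLocalization.mk ⟨d, a w, a v, Submonoid.mem_powers _⟩) =
        ψ (HomogeneousLocalization.mk ⟨d, a w, a v, Submonoid.mem_powers _⟩)) → φ = ψ)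
    {Z : Scheme.{u}} {z : Proj 𝒜 ⟶ Z} {s : S ⟶ Z}
    (hloc : ∀ (v : ι) (W : S.Opens), IsGen (resM (ρ v) (le_top : W ≤ ⊤)) →
      ∃ h : W.toScheme ⟶ Proj 𝒜, HasCoords 𝒜 a ρ W.ι h ∧ h ≫ z = W.ι ≫ s) :
    ∃ h : S ⟶ Proj 𝒜, HasCoords 𝒜 a ρ (𝟙 S) h ∧ h ≫ z = s := by
  choose v W hsW hv using hρ
  choose h hh hz using fun s => hloc (v s) (W s) (hv s)
  let 𝒰 : S.OpenCover := S.openCoverOfIsOpenCover W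
    (IsOpenCover.mk (top_le_iff.1 fun s _ => Opens.mem_iSup.2 ⟨s, hsW s⟩))
  -- On an overlap both morphisms have the coordinates `ρ`, along the same map to `S`, so uniqueness
  -- makes them equal.
  have hf (x y : S) : Limits.pullback.fst (𝒰.f x) (𝒰.f y) ≫ h x = Limits.pullback.snd _ _ ≫ h y := by
    refine HasCoords.unique hd (fun s => ⟨v s, W s, hsW s, hv s⟩) hgen
      ((hh x).comp (Limits.pullback.fst (𝒰.f x) (𝒰.f y))) ?_
    have := (hh y).comp (Limits.pullback.snd (𝒰.f x) (𝒰.f y))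
    exact (congrArg (fun j => HasCoords 𝒜 a ρ j _) Limits.pullback.condition).mpr this
  have hι (x : S) : (W x).ι ≫ 𝒰.glueMorphisms h hf = h x := 𝒰.ι_glueMorphisms h hf x
  refine ⟨𝒰.glueMorphisms h hf, .of_openCover 𝒰 fun (x : S) => ?_, 𝒰.hom_ext _ _ fun (x : S) => ?_⟩
  · change HasCoords 𝒜 a ρ ((W x).ι ≫ 𝟙 S) ((W x).ι ≫ 𝒰.glueMorphisms h hf)
    rw [hι, Category.comp_id]
    exact hh x
  · change (W x).ι ≫ 𝒰.glueMorphisms h hf ≫ z = (W x).ι ≫ s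
    rw [reassoc_of% hι, hz]

end Coordinates

/-! ### Invertible sheaves with coordinates as pullbacks of the twisting sheaf -/

section Pullback

variable {A : Type u} {σ : Type*} [CommRing A] [SetLike σ A] [AddSubgroupClass σ A]
  {𝒜 : ℕ → σ} [GradedRing 𝒜] {ι : Type u} {d : ℕ} {a : ι → 𝒜 d}
  {S : Scheme.{u}} {L M : S.Modules} {ρ : ι → Γ(L, ⊤)} {τ : ι → Γ(M, ⊤)}

lemma resM_app_smul (φ : L ⟶ M) {W : S.Opens} {b c : Γ(L, ⊤)} {g : Γ(S, W)}
    (h : resM c (le_top : W ≤ ⊤) = g • resM b le_top) :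
    resM (φ.app ⊤ c) (le_top : W ≤ ⊤) = g • resM (φ.app ⊤ b) le_top := by
  rw [resM_app, h, Scheme.Modules.Hom.app_smul, resM_app]

lemma HasCoords.of_iso (e : L ≅ M) (he : ∀ v, e.hom.app ⊤ (ρ v) = τ v) {T : Scheme.{u}} {j : T ⟶ S}
    {h : T ⟶ Proj 𝒜} (H : HasCoords 𝒜 a τ j h) : HasCoords 𝒜 a ρ j h := fun W v hv => by
  have hv' : IsGen (resM (τ v) (le_top : W ≤ ⊤)) := by
    rw [← he, resM_app]
    exact hv.app e
  refine (H W v hv').imp_right fun H' w g hg => H' w g ?_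
  rw [← he, ← he]
  exact resM_app_smul e.hom hg

variable (h : S ⟶ Proj 𝒜)

lemma resM_pullback_twistSection (b c : 𝒜 d) {U : S.Opens} (hU : U ≤ h ⁻¹ᵁ Proj.basicOpen 𝒜 b.1) :
    resM (pullbackSection h (twistSection 𝒜 d c)) (le_top : U ≤ ⊤) =
      h.appLE _ U hU (fracSection 𝒜 b c) • resM (pullbackSection h (twistSection 𝒜 d b)) le_top := by
  have h1 := congrArg (fun x => resM x hU)
    (resM_pullbackSection_smul h _ _ _ (resM_twistSection_eq 𝒜 b c))
  simp only [resM_resM, resM_smul] at h1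
  exact h1

lemma isGen_pullback_twistSection (b : 𝒜 d) {U : S.Opens} (hU : U ≤ h ⁻¹ᵁ Proj.basicOpen 𝒜 b.1) :
    IsGen (resM (pullbackSection h (twistSection 𝒜 d b)) (le_top : U ≤ ⊤)) := by
  have := ((isGen_twistSection 𝒜 b).resM_pullbackSection h).res hU
  rwa [resM_resM] at this

variable {h}

/-- With the pulled back sections as `ρ`, the coordinates can be read off from the morphism. This
needs that `h` lands in the chart of `a v` wherever the pullback of `a v` generates. -/
lemma hasCoords_pullback (hcov : ∀ x : Proj 𝒜, ∃ v, x ∈ Proj.basicOpen 𝒜 (a v).1) :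
    HasCoords 𝒜 a (fun v => pullbackSection h (twistSection 𝒜 d (a v))) (𝟙 S) h :=
  fun W v hv => by
  refine ⟨fun s hs => ?_, fun w g hg U e e' => ?_⟩
  -- In a chart `a u` around `h s`, both pullbacks generate, so the function `a v / a u` pulls back
  -- to a unit and `a v` does not vanish at `h s`.
  · obtain ⟨u, hu⟩ := hcov (h s)
    let U := W ⊓ h ⁻¹ᵁ Proj.basicOpen 𝒜 (a u).1
    have hv' : IsGen (resM (pullbackSection h (twistSection 𝒜 d (a v))) (le_top : U ≤ ⊤)) := by
      simpa only [resM_resM] using hv.res (inf_le_left : U ≤ W)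
    have hU : U ≤ h ⁻¹ᵁ Proj.basicOpen 𝒜 (a u).1 := inf_le_right
    rw [resM_pullback_twistSection h (a u) (a v) hU] at hv'
    have h1 := S.basicOpen_of_isUnit ((isGen_pullback_twistSection h (a u) hU).isUnit_of_smul hv')
    rw [Scheme.basicOpen_appLE] at h1
    have h2 : s ∈ U ⊓ h ⁻¹ᵁ (Proj 𝒜).basicOpen (fracSection 𝒜 (a u) (a v)) := h1.symm.le ⟨hs, hu⟩
    exact basicOpen_fracSection_le 𝒜 _ _ h2.2
  · refine (isGen_pullback_twistSection h (a v) e').smul_injective ?_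
    rw [← resM_pullback_twistSection h (a v) (a w) e']
    have h1 := congrArg (fun x => resM x (show U ≤ W from e)) hg
    simp only [resM_resM, resM_smul] at h1
    rw [h1]
    congr 1

/-- Wherever `ρ v` generates, the pullback of `a v` generates too, and the coordinate of every `ρ w`
is the pullback of `a w / a v`. The two families therefore have the same coordinates. -/
lemma HasCoords.exists_iso (hρ : LocallyGen ρ) (H : HasCoords 𝒜 a ρ (𝟙 S) h) :
    ∃ e : (Scheme.Modules.pullback h).obj (twist 𝒜 d) ≅ L,
      ∀ v, e.hom.app ⊤ (pullbackSection h (twistSection 𝒜 d (a v))) = ρ v := by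
  refine exists_iso_of_sameCoords (ρ := fun v => pullbackSection h (twistSection 𝒜 d (a v))) fun s => ?_
  obtain ⟨v, W, hs, hv⟩ := hρ s
  obtain ⟨h1, h2⟩ := H W v hv
  refine ⟨W, v, hs, isGen_pullback_twistSection h (a v) h1, hv, fun w => ?_⟩
  obtain ⟨g, hg⟩ := hv.exists_smul (resM (ρ w) le_top)
  refine ⟨h.appLE _ W h1 (fracSection 𝒜 (a v) (a w)), resM_pullback_twistSection h (a v) (a w) h1, ?_⟩
  rw [hg, h2 w g hg W le_rfl h1]
  congr 1
  exact (resO_self g le_rfl).symm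

end Pullback

/-! ### The coordinate rings of the affine charts, and the structure morphism -/

section Generators

variable {F A ι : Type u} [Field F] [CommRing A] [Algebra F A] {𝒜 : ℕ → Submodule F A}
  [GradedAlgebra 𝒜] (x : ι → 𝒜 1)

/-- The quotient `x w / x v`. -/
def awayFrac (v w : ι) : HomogeneousLocalization.Away 𝒜 (x v).1 :=
  HomogeneousLocalization.mk ⟨1, x w, x v, Submonoid.mem_powers _⟩

omit [GradedAlgebra 𝒜] in
lemma val_awayFrac_mul (v w : ι) :
    (awayFrac x v w).val * algebraMap A (Localization.Away (x v).1) (x v).1 =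
      algebraMap _ _ (x w).1 := by
  rw [awayFrac, HomogeneousLocalization.val_mk, Localization.mk_eq_mk']
  exact IsLocalization.mk'_spec _ _ _

variable {x}

/-- An element of degree `n` is a combination of `n`-fold products of the `x w`; dividing each
factor by `x v` leaves a polynomial in the fractions. -/
lemma exists_val_mul_eq (h𝒜 : ∀ n, 𝒜 n = Submodule.span F (Set.range fun v => (x v).1) ^ n)
    (hx : ∀ (c : F), c ≠ 0 → ∀ v, ∃ w, (x w).1 = algebraMap F A c * (x v).1) (v : ι)
    (R : Subring (HomogeneousLocalization.Away 𝒜 (x v).1))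
    (hR : ∀ w, awayFrac x v w ∈ R) (n : ℕ) (r : A) (hr : r ∈ 𝒜 n) :
    ∃ z ∈ R, z.val * algebraMap A (Localization.Away (x v).1) (x v).1 ^ n =
      algebraMap _ _ r := by
  -- Constants need not be put into `R`: a nonzero `c` is itself a fraction `x w / x v`, with `x w =
  -- c x v`.
  have hscalar (c : F) : ∃ z ∈ R,
      z.val = algebraMap A (Localization.Away (x v).1) (algebraMap F _ c) := by
    by_cases hc : c = 0
    · exact ⟨0, zero_mem R, by simp [hc]⟩
    obtain ⟨w, hw⟩ := hx c hc v
    refine ⟨awayFrac x v w, hR _, ?_⟩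
    refine (IsLocalization.Away.algebraMap_isUnit (x v).1).mul_left_injective ?_
    refine (val_awayFrac_mul x _ _).trans ?_
    rw [hw, map_mul]
  induction n generalizing r with
  | zero =>
    rw [h𝒜, pow_zero, Submodule.mem_one] at hr
    obtain ⟨c, rfl⟩ := hr
    simpa using hscalar c
  | succ n ih =>
    rw [h𝒜, pow_succ, ← h𝒜] at hr
    induction hr using Submodule.mul_induction_on' with
    | mem_mul_mem a ha b hb =>
      obtain ⟨z, hz, hz'⟩ := ih a ha
      have hb' : ∃ y ∈ R, y.val * algebraMap A (Localization.Away (x v).1) (x v).1 =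
            algebraMap _ _ b := by
        clear hz' ha ih
        induction hb using Submodule.span_induction with
        | mem x h => obtain ⟨w, rfl⟩ := h; exact ⟨_, hR w, val_awayFrac_mul _ v w⟩
        | zero => exact ⟨0, zero_mem R, by simp⟩
        | add x y _ _ hx hy =>
          obtain ⟨p, hp, hp'⟩ := hx
          obtain ⟨q, hq, hq'⟩ := hy
          exact ⟨p + q, add_mem hp hq, by
            rw [HomogeneousLocalization.val_add, add_mul, hp', hq', map_add]⟩
        | smul c x _ hx =>
          obtain ⟨p, hp, hp'⟩ := hx
          obtain ⟨q, hq, hq'⟩ := hscalar c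
          exact ⟨q * p, mul_mem hq hp, by
            rw [HomogeneousLocalization.val_mul, mul_assoc, hp', hq', Algebra.smul_def, map_mul]⟩
      obtain ⟨y, hy, hy'⟩ := hb'
      exact ⟨z * y, mul_mem hz hy, by
        rw [HomogeneousLocalization.val_mul, pow_succ, mul_mul_mul_comm, hz', hy', map_mul]⟩
    | add x _ y _ hx hy =>
      obtain ⟨p, hp, hp'⟩ := hx
      obtain ⟨q, hq, hq'⟩ := hy
      exact ⟨p + q, add_mem hp hq, by
        rw [HomogeneousLocalization.val_add, add_mul, hp', hq', map_add]⟩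

lemma subring_away_eq_top (h𝒜 : ∀ n, 𝒜 n = Submodule.span F (Set.range fun v => (x v).1) ^ n)
    (hx : ∀ (c : F), c ≠ 0 → ∀ v, ∃ w, (x w).1 = algebraMap F A c * (x v).1) (v : ι)
    (R : Subring (HomogeneousLocalization.Away 𝒜 (x v).1))
    (hR : ∀ w, awayFrac x v w ∈ R) : R = ⊤ := by
  rw [eq_top_iff]
  intro y _
  obtain ⟨n, r, hr, rfl⟩ := HomogeneousLocalization.Away.mk_surjective 𝒜 (x v).2 y
  obtain ⟨z, hz, hz'⟩ := exists_val_mul_eq h𝒜 hx v R hR n r (by simpa using hr)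
  convert hz
  apply HomogeneousLocalization.val_injective
  have hu := IsLocalization.Away.algebraMap_isUnit (S := Localization.Away (x v).1) (x v).1
  refine (hu.pow n).mul_left_injective (Eq.trans ?_ hz'.symm)
  change _ * algebraMap A _ (x v).1 ^ n = _
  rw [HomogeneousLocalization.Away.val_mk, Localization.mk_eq_mk', ← map_pow]
  exact IsLocalization.mk'_spec _ _ _

/-- The elements where two homomorphisms agree form a subring, and it contains the fractions. -/
lemma away_hom_ext (h𝒜 : ∀ n, 𝒜 n = Submodule.span F (Set.range fun v => (x v).1) ^ n)
    (hx : ∀ (c : F), c ≠ 0 → ∀ v, ∃ w, (x w).1 = algebraMap F A c * (x v).1) (v : ι)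
    {B : Type u} [CommRing B] (φ ψ : HomogeneousLocalization.Away 𝒜 (x v).1 →+* B)
    (h : ∀ w, φ (awayFrac x v w) = ψ (awayFrac x v w)) : φ = ψ := by
  have h1 := subring_away_eq_top h𝒜 hx v (RingHom.eqLocus φ ψ) h
  ext y
  exact (h1 ▸ Subring.mem_top y : y ∈ RingHom.eqLocus φ ψ)

/-- Homomorphisms from the degree zero part of a localization. -/
lemma exists_away_hom {B : Type u} [CommRing B] (f : A →+* B) (v : ι) (hv : f (x v).1 = 1) :
    ∃ φ : HomogeneousLocalization.Away 𝒜 (x v).1 →+* B,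
      (∀ w, φ (awayFrac x v w) = f (x w).1) ∧
      ∀ r, φ (HomogeneousLocalization.fromZeroRingHom 𝒜 _ r) = f r.1 := by
  have hu : IsUnit (f (x v).1) := hv ▸ isUnit_one
  let ψ : Localization.Away (x v).1 →+* B := IsLocalization.Away.lift _ hu
  have hψ (r) : ψ (algebraMap _ _ r) = f r := IsLocalization.Away.lift_eq _ hu r
  refine ⟨ψ.comp (algebraMap _ (Localization.Away (x v).1)), fun w => ?_, fun r => ?_⟩
  · have h := congrArg ψ (val_awayFrac_mul x v w)
    rw [map_mul, hψ, hψ, hv, mul_one] at h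
    exact h
  · refine Eq.trans (congrArg ψ ?_) (hψ r.1)
    exact Localization.mk_one_eq_algebraMap r.1

end Generators

/-! ### The structure morphism of `Proj` over `F` -/

section Structure

variable {F : Type u} [Field F]

lemma hom_eq_toSpecΓ (X : SchemeOver F) :
    X.hom = X.left.toSpecΓ ≫ Spec.map (CommRingCat.ofHom (scalar X)) := by
  have h : CommRingCat.ofHom (scalar X) = (Scheme.ΓSpecIso (CommRingCat.of F)).inv ≫ X.hom.appTop :=
    rfl
  rw [h, Spec.map_comp, ← Scheme.toSpecΓ_naturality_assoc]
  simp

lemma ι_hom_eq_toSpecΓ {X : Scheme.{u}} (p : X ⟶ Spec (CommRingCat.of F)) (U : X.Opens) :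
    U.ι ≫ p = U.toSpecΓ ≫ Spec.map
      (CommRingCat.ofHom (scalar (Over.mk p)) ≫ X.presheaf.map (homOfLE le_top).op) := by
  have h := hom_eq_toSpecΓ (Over.mk p)
  rw [Spec.map_comp, Scheme.Opens.toSpecΓ_SpecMap_presheaf_map_top_assoc]
  exact congrArg (U.ι ≫ ·) h

variable {A : Type u} [CommRing A] [Algebra F A] (𝒜 : ℕ → Submodule F A) [GradedAlgebra 𝒜]

/-- The structure morphism of `Proj 𝒜` over `F`. -/
abbrev projStr : Proj 𝒜 ⟶ Spec (CommRingCat.of F) :=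
  Proj.toSpecZero 𝒜 ≫ Spec.map (CommRingCat.ofHom (algebraMap F (𝒜 0)))

lemma ι_toSpecZero {f : A} {m : ℕ} (hf : f ∈ 𝒜 m) (hm : 0 < m) :
    (Proj.basicOpen 𝒜 f).ι ≫ Proj.toSpecZero 𝒜 = (Proj.basicOpen 𝒜 f).toSpecΓ ≫
      Spec.map (CommRingCat.ofHom (HomogeneousLocalization.fromZeroRingHom 𝒜 _) ≫
        Proj.awayToSection 𝒜 f) := by
  have h : (Proj.basicOpen 𝒜 f).ι = Proj.basicOpenToSpec 𝒜 f ≫ Proj.awayι 𝒜 f hf hm := by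
    rw [Proj.awayι, ← Proj.basicOpenIsoSpec_hom 𝒜 f hf hm, Iso.hom_inv_id_assoc]
  rw [h, Category.assoc, Proj.awayι_toSpecZero, Spec.map_comp, Proj.basicOpenToSpec, Category.assoc]

/-- The chart has two descriptions of its morphism to `Spec F`, one through the global scalars and
one through the degree zero part. Comparing functions gives the scalars in the coordinate ring. -/
lemma resO_scalar_proj {f : A} {m : ℕ} (hf : f ∈ 𝒜 m) (hm : 0 < m) (c : F) :
    resO (S := Proj 𝒜) (scalar (Over.mk (projStr 𝒜)) c) (le_top : Proj.basicOpen 𝒜 f ≤ ⊤) =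
      Proj.awayToSection 𝒜 f
        (HomogeneousLocalization.fromZeroRingHom 𝒜 _ (algebraMap F _ c)) := by
  have h1 : (Proj.basicOpen 𝒜 f).toSpecΓ ≫ Spec.map
      (CommRingCat.ofHom (scalar (Over.mk (projStr 𝒜))) ≫
        (Proj 𝒜).presheaf.map (homOfLE le_top).op) = (Proj.basicOpen 𝒜 f).toSpecΓ ≫
      Spec.map (CommRingCat.ofHom (algebraMap F (𝒜 0)) ≫
        CommRingCat.ofHom (HomogeneousLocalization.fromZeroRingHom 𝒜 _) ≫
          Proj.awayToSection 𝒜 f) := by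
    rw [← ι_hom_eq_toSpecΓ, Spec.map_comp (CommRingCat.ofHom (algebraMap F (𝒜 0))),
      ← Category.assoc, ι_toSpecZero 𝒜 hf hm, Category.assoc]
  have h2 := Opens_toSpecΓ_map_injective (Proj.basicOpen 𝒜 f) h1
  have h3 := ConcreteCategory.congr_hom h2 c
  simp only [ConcreteCategory.comp_apply] at h3
  exact h3

lemma valueO_resO_scalar_proj {f : A} {m : ℕ} (hf : f ∈ 𝒜 m) (hm : 0 < m) (c : F)
    (x : Proj.basicOpen 𝒜 f) :
    valueO 𝒜 (resO (S := Proj 𝒜) (scalar (Over.mk (projStr 𝒜)) c)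
      (le_top : Proj.basicOpen 𝒜 f ≤ ⊤)) x = algebraMap A _ (algebraMap F A c) := by
  rw [resO_scalar_proj 𝒜 hf hm]
  refine (ProjectiveSpectrum.Proj.awayToSection_apply 𝒜 f _ x).trans ?_
  refine (congrArg _ (Localization.mk_one_eq_algebraMap (algebraMap F A c))).trans ?_
  exact IsLocalization.map_eq _ _

end Structure

/-! ### The charts of `Q_V` -/

section Projective

variable (F : Type u) [Field F] (V : Type u) [AddCommGroup V] [Module F V]

/-- The element `1/v`, as a homogeneous element of degree one. -/
def recipOne (v : Nonzero V) : gradeRV F V 1 :=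
  ⟨recip F V v, by rw [gradeRV, pow_one]; exact Submodule.subset_span ⟨v, rfl⟩⟩

/-- The `1/v` have degree one and generate `R_V` as an algebra over its degree zero part, so no
point of `Proj` kills them all. -/
lemma exists_mem_basicOpen_recip (x : Proj (gradeRV F V)) :
    ∃ v, x ∈ Proj.basicOpen (gradeRV F V) (recipOne F V v).1 := by
  rw [← Opens.mem_iSup, Proj.iSup_basicOpen_eq_top' _ _ fun v => ⟨1, (recipOne F V v).2⟩]
  · trivial
  · rw [eq_top_iff]
    intro r _
    have hr : r ∈ Algebra.adjoin F (Set.range (recip F V)) := by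
      rw [adjoin_range_recip]
      trivial
    induction hr using Algebra.adjoin_induction with
    | mem x h => exact Algebra.subset_adjoin h
    | algebraMap c =>
      exact Subalgebra.algebraMap_mem (Algebra.adjoin (gradeRV F V 0) _)
        (algebraMap F (gradeRV F V 0) c)
    | add x y _ _ hx hy => exact add_mem (hx trivial) (hy trivial)
    | mul x y _ _ hx hy => exact mul_mem (hx trivial) (hy trivial)

lemma gradeRV_eq (n : ℕ) :
    gradeRV F V n = Submodule.span F (Set.range fun v => (recipOne F V v).1) ^ n := rfl

end Projective

/-! ### `Proj` of a graded ring with a universal reciprocal map -/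

section Universal

variable {F V A : Type u} [Field F] [AddCommGroup V] [Module F V] [CommRing A] [Algebra F A]
  {𝒜 : ℕ → Submodule F A} [GradedAlgebra 𝒜] {x : Nonzero V → 𝒜 1}

lemma IsRecPair.locallyGen {S : SchemeOver F} {L : S.left.Modules} {ρ : Nonzero V → Γ(L, ⊤)}
    (h : IsRecPair S L ρ) : LocallyGen ρ :=
  (fiberwiseNonzero_iff h.invertible ρ).1 h.fiberwiseNonzero

lemma mul_eq_mul_add_of_isUnit {R : Type*} [CommRing R] {a p q r b c d : R} (ha : IsUnit a)
    (hp : p * a = b) (hq : q * a = c) (hr : r * a = d) (h : b * c = d * (b + c)) :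
    p * q = r * (p + q) := by
  refine (ha.mul ha).mul_left_injective ?_
  subst hp hq hr
  linear_combination h

/-- This is the reciprocal relation divided by the square of `x u`, checked in the stalks, where `x
u` is a unit. -/
lemma fracSection_mul_eq (hx : IsReciprocalRing (algebraMap F A) fun v => (x v).1)
    (u v w : Nonzero V) (h : v.1 + w.1 ≠ 0) :
    fracSection 𝒜 (x u) (x v) * fracSection 𝒜 (x u) (x w) =
      fracSection 𝒜 (x u) (x ⟨v.1 + w.1, h⟩) *
        (fracSection 𝒜 (x u) (x v) + fracSection 𝒜 (x u) (x w)) := by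
  refine valueO_ext 𝒜 fun s => ?_
  rw [valueO_mul, valueO_mul, valueO_add]
  refine mul_eq_mul_add_of_isUnit (isUnit_algebraMap_locAt 𝒜 s.2)
    (valueO_fracSection_mul 𝒜 (x u) (x v) s) (valueO_fracSection_mul 𝒜 (x u) (x w) s)
    (valueO_fracSection_mul 𝒜 (x u) (x ⟨v.1 + w.1, h⟩) s) ?_
  have h1 := congrArg (algebraMap A (LocAt 𝒜 s.1)) (hx.map_add v w h)
  rwa [map_mul, map_mul, _root_.map_add] at h1

lemma isRecPair_twist (hx : IsReciprocalRing (algebraMap F A) fun v => (x v).1)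
    (hcov : ∀ s : Proj 𝒜, ∃ v, s ∈ Proj.basicOpen 𝒜 (x v).1) :
    IsRecPair (Over.mk (projStr 𝒜)) (twist 𝒜 1) fun v => twistSection 𝒜 1 (x v) := by
  have hinv : IsInvertible (twist 𝒜 1) := isInvertible_iff.2 fun s => by
    obtain ⟨v, hv⟩ := hcov s
    exact ⟨_, _, hv, isGen_twistSection 𝒜 (x v)⟩
  refine ⟨hinv, ⟨fun α hα v => ?_, fun v w h => ?_⟩, (fiberwiseNonzero_iff hinv _).2 fun s => ?_⟩
  · refine resM_ext (S := Proj 𝒜) fun s _ => ?_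
    obtain ⟨u, hu⟩ := hcov s
    refine ⟨_, le_top, hu, ?_⟩
    refine Eq.trans ?_ (resM_smul (S := Proj 𝒜) (scalar (Over.mk (projStr 𝒜)) α⁻¹)
      (twistSection 𝒜 1 (x v)) le_top).symm
    refine valueM_ext 𝒜 fun y => ?_
    rw [valueM_smul, valueO_resO_scalar_proj 𝒜 (x u).2 one_pos, valueM_resM_twistSection,
      valueM_resM_twistSection, ← map_mul]
    exact congrArg _ (hx.map_smul α hα v)
  · refine secMul_eq_of_locally (S := Proj 𝒜) fun s => ?_
    obtain ⟨u, hu⟩ := hcov s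
    refine ⟨_, _, _, _, _, _, hu, resM_twistSection_eq 𝒜 (x u) (x v),
      resM_twistSection_eq 𝒜 (x u) (x w), resM_twistSection_eq 𝒜 (x u) (x ⟨v.1 + w.1, h⟩),
      ?_, fracSection_mul_eq hx u v w h⟩
    rw [resM_add, resM_twistSection_eq 𝒜 (x u) (x v), resM_twistSection_eq 𝒜 (x u) (x w), add_smul]
  · obtain ⟨v, hv⟩ := hcov s
    exact ⟨v, _, hv, isGen_twistSection 𝒜 (x v)⟩

/-- The coordinates of a reciprocal map with respect to one of its values that is a generator. -/
lemma IsReciprocal.isReciprocalRing_coords {S : SchemeOver F} {L : S.left.Modules}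
    {ρ : Nonzero V → Γ(L, ⊤)} (h : IsReciprocal S L ρ) {W : S.left.Opens} {t : Γ(L, W)}
    (ht : IsGen t) {g : Nonzero V → Γ(S.left, W)}
    (hg : ∀ w, resM (ρ w) (le_top : W ≤ ⊤) = g w • t) :
    IsReciprocalRing ((S.left.presheaf.map (homOfLE (le_top : W ≤ ⊤)).op).hom.comp (scalar S)) g where
  map_smul α hα v := by
    refine ht.smul_injective ?_
    rw [← hg, h.map_smul, resM_smul, hg, smul_smul]
    rfl
  map_add v w hvw := by
    refine ht.mul_eq_of_secMul_eq (h.map_add v w hvw) (hg v) (hg w) (hg _) ?_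
    rw [resM_add, hg, hg, add_smul]

/-- Dividing by `ρ v` gives a reciprocal map into the functions on `W`, hence a homomorphism `f`
from `A`. Since `f` sends `x v` to `1`, it induces a homomorphism from the coordinate ring of the
chart of `x v`. -/
lemma exists_hasCoords_of_isRecPair
    (huniv : ∀ (B : Type u) [CommRing B] [Algebra F B] (ρ : Nonzero V → B),
      IsReciprocalRing (algebraMap F B) ρ → ∃ f : A →ₐ[F] B, ∀ v, f (x v).1 = ρ v)
    {S : SchemeOver F} {L : S.left.Modules} {ρ : Nonzero V → Γ(L, ⊤)} (h : IsReciprocal S L ρ)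
    (v : Nonzero V) (W : S.left.Opens) (hv : IsGen (resM (ρ v) (le_top : W ≤ ⊤))) :
    ∃ k : W.toScheme ⟶ Proj 𝒜, HasCoords 𝒜 x ρ W.ι k ∧ k ≫ projStr 𝒜 = W.ι ≫ S.hom := by
  choose g hg using fun w => hv.exists_smul (resM (ρ w) (le_top : W ≤ ⊤))
  let T : SchemeOver F := Over.mk (W.ι ≫ S.hom)
  let j : T ⟶ S := Over.homMk W.ι
  have hj : ⊤ ≤ W.ι ⁻¹ᵁ W := fun t _ => t.2
  let _ : Algebra F Γ(W.toScheme, ⊤) := (scalar T).toAlgebra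
  have hrec : IsReciprocalRing (algebraMap F Γ(W.toScheme, ⊤)) fun w => W.ι.appLE W ⊤ hj (g w) := by
    refine (h.isReciprocalRing_coords hv hg).map (W.ι.appLE W ⊤ hj).hom fun c => ?_
    refine (appLE_resO W.ι le_top hj (scalar S c)).trans ?_
    refine Eq.trans ?_ (scalar_map j c)
    exact ConcreteCategory.congr_hom (Scheme.Hom.appLE_eq_app W.ι) (scalar S c)
  obtain ⟨f, hf⟩ := huniv _ _ hrec
  have hgv : g v = 1 := hv.smul_injective (by rw [← hg, one_smul])
  obtain ⟨φ, hφ, hφ₀⟩ := exists_away_hom f.toRingHom v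
    ((hf v).trans (by rw [hgv, map_one]))
  obtain ⟨k, hk, hk₀⟩ := exists_hasCoords_of_away one_pos hv hj g hg (CommRingCat.ofHom φ)
    fun w => (hφ w).trans (hf w)
  refine ⟨k, hk, ?_⟩
  have h1 := hom_eq_toSpecΓ T
  refine Eq.trans ?_ h1.symm
  rw [projStr, reassoc_of% hk₀, ← Spec.map_comp]
  congr 2
  ext c
  exact (hφ₀ _).trans (f.commutes c)

variable (hx : IsReciprocalRing (algebraMap F A) fun v => (x v).1)
    (hcov : ∀ s : Proj 𝒜, ∃ v, s ∈ Proj.basicOpen 𝒜 (x v).1)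
    (h𝒜 : ∀ n, 𝒜 n = Submodule.span F (Set.range fun v => (x v).1) ^ n)
    (huniv : ∀ (B : Type u) [CommRing B] [Algebra F B] (ρ : Nonzero V → B),
      IsReciprocalRing (algebraMap F B) ρ → ∃ f : A →ₐ[F] B, ∀ v, f (x v).1 = ρ v)

include hx h𝒜 in
lemma away_hom_ext_of_isReciprocalRing (v : Nonzero V) (B : CommRingCat.{u})
    (φ ψ : CommRingCat.of (HomogeneousLocalization.Away 𝒜 (x v).1) ⟶ B)
    (h : ∀ w, φ (awayFrac x v w) = ψ (awayFrac x v w)) : φ = ψ :=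
  CommRingCat.hom_ext (away_hom_ext h𝒜 (fun c hc v => by
    -- Reciprocal maps invert scalars, so `c x v` is the value at `c⁻¹ v`.
    have h := hx.map_smul c⁻¹ (inv_ne_zero hc) v
    rw [inv_inv] at h
    exact ⟨_, h⟩) v φ.hom ψ.hom h)

-- Injectivity: an isomorphism of the two pulled back pairs gives both morphisms the same
-- coordinates. Surjectivity: the morphisms on the charts glue, and equal coordinates identify the
-- pair with the pullback of the universal one.
include h𝒜 huniv in
theorem proj_represents :
    ∃ e : (recFunctor F V).RepresentableBy (Over.mk (projStr 𝒜)),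
      e.homEquiv (𝟙 _) = Quotient.mk _ ⟨twist 𝒜 1, _, isRecPair_twist hx hcov⟩ := by
  have hext := away_hom_ext_of_isReciprocalRing hx h𝒜
  refine exists_representableBy _ fun S => ⟨fun f g hfg => ?_, fun q => ?_⟩
  · obtain ⟨e, he⟩ := Quotient.exact hfg
    refine Over.OverMorphism.ext ?_
    exact HasCoords.unique one_pos ((isRecPair_twist hx hcov).pullback f).locallyGen hext
      (hasCoords_pullback hcov) ((hasCoords_pullback hcov).of_iso e he)
  · induction q using Quotient.inductionOn with | _ P =>
    obtain ⟨k, hk, hks⟩ := exists_hasCoords one_pos P.isRecPair.locallyGen hext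
      (exists_hasCoords_of_isRecPair huniv P.isRecPair.reciprocal)
    exact ⟨Over.homMk k hks, Quotient.sound (hk.exists_iso P.isRecPair.locallyGen)⟩

end Universal

end RecipMaps

end

theorem theorem6p4 (F : Type u) [Field F] [Finite F]
    (V : Type u) [AddCommGroup V] [Module F V] [FiniteDimensional F V] [Nontrivial V] :
    (∃ (h : IsRecPair (QV F V) (OOne F V) (rhoV F V))
      (e : (recFunctor F V).RepresentableBy (QV F V)),
      e.homEquiv (𝟙 (QV F V)) = Quotient.mk _ ⟨OOne F V, rhoV F V, h⟩) ∧
    (∃ (h : IsReciprocalRing (scalar (coneQV F V)) (rhoCone F V))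
      (e : (affineRecFunctor F V).RepresentableBy (coneQV F V)),
      e.homEquiv (𝟙 (coneQV F V)) = ⟨rhoCone F V, h⟩) :=
  ⟨⟨isRecPair_twist (x := recipOne F V) isReciprocalRing_recip (exists_mem_basicOpen_recip F V),
    proj_represents (x := recipOne F V) isReciprocalRing_recip (exists_mem_basicOpen_recip F V)
      (gradeRV_eq F V) fun _ _ _ _ h => h.exists_algHom⟩, coneQV_represents F V⟩
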